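/- Trees are finite, rooted, ordered, full binary trees. For a finite alphabet $\Gamma$, a $\Gamma$-tree $(T,\lambda)$ is a tree $T$ with a function $\lambda$ assigning to each node a set of labels $\lambda(n)\subseteq\Gamma$. MSO formulas on $\Gamma$-trees use the relations $E_1$ (first child), $E_2$ (second child), the unary predicates $P_l$ for $l\in\Gamma$, and equality. An MSO query $Q(\mathbf x,\mathbf X)$ is an MSO formula with free first-order variables $\mathbf x$ and free second-order variables $\mathbf X$ (either tuple may be empty); its output $Q(T,\lambda)$ is the set of tuples of nodes and of sets of nodes of $T$ that satisfy it on $(T,\lambda)$. A relabeling is a pair $(n,l)$ of a node and a label; applying it adds $l$ to $\lambda(n)$ if $l\notin\lambda(n)$ and removes it otherwise. Algorithms run on a RAM with uniform cost measure: nodes and labels are represented by numbers, a tree by its root and arrays of child pointers, a labeling by one $0/1$ array per label; the arithmetic is addition and subtraction, and on a tree $T$ all computed numbers are $O(|T|)$. **Lemma.** Given a finite alphabet $\Gamma$ and an MSO query $Q$ on $\Gamma$-trees, one can compute a finite alphabet $\Gamma'\supseteq\Gamma$ and an MSO query $Q'$ on $\Gamma'$-trees, with the same free variables, such that the following holds,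 where all constants in $O(\cdot)$ and both algorithms depend only on $\Gamma$ and $Q$. For every unlabeled tree $T$ with node set $N$ there is a $\Gamma'$-tree $(T',\lambda')$ with node set $N'\supseteq N$ and height $O(\log(|T|+1))$ such that, for every labeling $\lambda:N\to 2^\Gamma$, writing $\lambda'':N'\to 2^{\Gamma'}$ for the labeling that agrees with $\lambda$ on $N$ and with $\lambda'$ on $N'\setminus N$: 1. $Q'(T',\lambda'')=Q(T,\lambda)$; 2. an algorithm computes $(T',\lambda'')$ from $(T,\lambda)$ in time $O(|T|)$; 3. every relabeling $(n,l)$ of $T$ corresponds to a relabeling $(n',l')$ of $T'$, which does not depend on $\lambda$: the labeling of $T'$ associated with the relabeled $\lambda$ is the result of applying $(n',l')$ to $\lambda''$. An algorithm that is given the representation of $(T',\lambda'')$ and the pair $(n,l)$ computes $(n',l')$ and applies it to this representation in time $O(1)$. -/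

import Mathlib

/-! ### Trees -/

/-- Rooted, ordered, full binary trees whose nodes carry identifiers in `ℕ`.  In a leaf `leaf v` and
in an internal node `node v l r`, the number `v` is the identifier of the root; `l` and `r` are the
subtrees rooted at the first and at the second child. -/
inductive BinTree : Type
  | leaf (v : ℕ) : BinTree
  | node (v : ℕ) (l r : BinTree) : BinTree

namespace BinTree

/-- The root node. -/
def root : BinTree → ℕ
  | leaf v => v
  | node v _ _ => v

/-- The list of all nodes. -/
def nodes : BinTree → List ℕ
  | leaf v => [v]
  | node v l r => v :: (l.nodes ++ r.nodes)

/-- The number of nodes. -/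
def size (T : BinTree) : ℕ := T.nodes.length

/-- The height: the maximal number of edges on a path from the root to a leaf. -/
def height : BinTree → ℕ
  | leaf _ => 0
  | node _ l r => max l.height r.height + 1

/-- The nodes are exactly the numbers `0, …, size - 1`, each of which identifies one node. -/
def Numbered (T : BinTree) : Prop := T.nodes.Perm (List.range T.size)

/-- `T.Child1 u v`: the node `v` is the first child of the node `u`. -/
def Child1 : BinTree → ℕ → ℕ → Prop
  | leaf _, _, _ => False
  | node w l r, u, v => (u = w ∧ v = l.root) ∨ l.Child1 u v ∨ r.Child1 u v

/-- `T.Child2 u v`: the node `v` is the second child of the node `u`. -/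
def Child2 : BinTree → ℕ → ℕ → Prop
  | leaf _, _, _ => False
  | node w l r, u, v => (u = w ∧ v = r.root) ∨ l.Child2 u v ∨ r.Child2 u v

end BinTree

/-- Labeling functions for the alphabet `{0, …, k - 1}`: every node carries a set of labels.  (The
value at a number that is not a node of the tree under consideration is irrelevant.) -/
abbrev Labeling (k : ℕ) : Type := ℕ → Finset (Fin k)

/-- The relabeling `(v, l)`: add the label `l` to the node `v` if it is absent, and remove it if it
is present. -/
def Labeling.toggle {k : ℕ} (lam : Labeling k) (v : ℕ) (l : Fin k) : Labeling k :=
  Function.update lam v (if l ∈ lam v then (lam v).erase l else insert l (lam v))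

/-- The labeling over a larger alphabet that agrees with `lam` on the nodes `0, …, n - 1` and with
`mu` on all other nodes. -/
def Labeling.extend {k k' : ℕ} (hk : k ≤ k') (n : ℕ) (lam : Labeling k) (mu : Labeling k') :
    Labeling k' :=
  fun v => if v < n then (lam v).map (Fin.castLEEmb hk) else mu v

/-! ### Monadic second-order logic -/

/-- `MSO k p m`: formulas of monadic second-order logic on trees over the alphabet `{0, …, k - 1}`,
whose free variables are among `p` first-order variables and `m` second-order variables.  Variables
are de Bruijn indices: a quantifier binds the variable `0` of its body.  The other connectives and
the universal quantifiers are the usual abbreviations. -/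
inductive MSO (k : ℕ) : ℕ → ℕ → Type
  | eq {p m : ℕ} (x y : Fin p) : MSO k p m
  | child1 {p m : ℕ} (x y : Fin p) : MSO k p m
  | child2 {p m : ℕ} (x y : Fin p) : MSO k p m
  | label {p m : ℕ} (l : Fin k) (x : Fin p) : MSO k p m
  | mem {p m : ℕ} (x : Fin p) (X : Fin m) : MSO k p m
  | neg {p m : ℕ} (φ : MSO k p m) : MSO k p m
  | conj {p m : ℕ} (φ ψ : MSO k p m) : MSO k p m
  | ex1 {p m : ℕ} (φ : MSO k (p + 1) m) : MSO k p m
  | ex2 {p m : ℕ} (φ : MSO k p (m + 1)) : MSO k p m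

namespace MSO

/-- Satisfaction of a formula in the tree `T` with labeling `lam`, under an interpretation `a` of the
free first-order variables and an interpretation `B` of the free second-order variables. -/
def Sat {k : ℕ} (T : BinTree) (lam : Labeling k) :
    {p m : ℕ} → MSO k p m → (Fin p → ℕ) → (Fin m → Set ℕ) → Prop
  | _, _, eq x y, a, _ => a x = a y
  | _, _, child1 x y, a, _ => T.Child1 (a x) (a y)
  | _, _, child2 x y, a, _ => T.Child2 (a x) (a y)
  | _, _, label l x, a, _ => l ∈ lam (a x)
  | _, _, mem x X, a, B => a x ∈ B X
  | _, _, neg φ, a, B => ¬ Sat T lam φ a B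
  | _, _, conj φ ψ, a, B => Sat T lam φ a B ∧ Sat T lam ψ a B
  | _, _, ex1 φ, a, B => ∃ v ∈ T.nodes, Sat T lam φ (Fin.cons (α := fun _ => ℕ) v a) B
  | _, _, ex2 φ, a, B =>
      ∃ S : Set ℕ, (∀ v ∈ S, v ∈ T.nodes) ∧ Sat T lam φ a (Fin.cons (α := fun _ => Set ℕ) S B)

/-- The answers of a query on a labeled tree: all tuples of nodes and of sets of nodes of the tree
which, as interpretations of the free variables, satisfy the query. -/
def answers {k p m : ℕ} (Q : MSO k p m) (T : BinTree) (lam : Labeling k) :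
    Set ((Fin p → ℕ) × (Fin m → Set ℕ)) :=
  {A | (∀ i, A.1 i ∈ T.nodes) ∧ (∀ j, ∀ v ∈ A.2 j, v ∈ T.nodes) ∧ Q.Sat T lam A.1 A.2}

/-- The Gödel number of a formula (for given `k`, `p`, `m`). -/
def code {k : ℕ} : {p m : ℕ} → MSO k p m → ℕ
  | _, _, eq x y => Nat.pair 0 (Nat.pair x y)
  | _, _, child1 x y => Nat.pair 1 (Nat.pair x y)
  | _, _, child2 x y => Nat.pair 2 (Nat.pair x y)
  | _, _, label l x => Nat.pair 3 (Nat.pair l x)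
  | _, _, mem x X => Nat.pair 4 (Nat.pair x X)
  | _, _, neg φ => Nat.pair 5 φ.code
  | _, _, conj φ ψ => Nat.pair 6 (Nat.pair φ.code ψ.code)
  | _, _, ex1 φ => Nat.pair 7 φ.code
  | _, _, ex2 φ => Nat.pair 8 φ.code

/-- The Gödel number of a query, together with its alphabet and its numbers of free variables. -/
def queryCode {k p m : ℕ} (Q : MSO k p m) : ℕ :=
  Nat.pair k (Nat.pair p (Nat.pair m Q.code))

end MSO

/-! ### The RAM model -/

/-- A configuration of the random access machine: registers, and a memory that is divided into
arrays.  A program can name only finitely many registers and arrays; cells of arrays are accessed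
through addresses held in registers. -/
structure RamState where
  reg : ℕ → ℕ
  arr : ℕ → ℕ → ℕ

/-- Assign a value to a register. -/
def RamState.setReg (s : RamState) (x c : ℕ) : RamState :=
  { s with reg := Function.update s.reg x c }

/-- Assign a value to cell `i` of array `a`. -/
def RamState.setArr (s : RamState) (a i c : ℕ) : RamState :=
  { s with arr := Function.update s.arr a (Function.update (s.arr a) i c) }

/-- Programs of the random access machine. -/
inductive RamProg : Type
  /-- do nothing -/
  | skip : RamProg
  /-- `reg x := c` -/
  | const (x c : ℕ) : RamProg
  /-- `reg x := reg y + reg z` -/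
  | add (x y z : ℕ) : RamProg
  /-- `reg x := reg y - reg z` (which is `0` if `reg y < reg z`) -/
  | sub (x y z : ℕ) : RamProg
  /-- `reg x := arr a [reg y]` -/
  | load (x a y : ℕ) : RamProg
  /-- `arr a [reg x] := reg y` -/
  | store (a x y : ℕ) : RamProg
  /-- run `P`, then `P'` -/
  | seq (P P' : RamProg) : RamProg
  /-- if `reg x ≠ 0`, run `P`, otherwise run `P'` -/
  | cond (x : ℕ) (P P' : RamProg) : RamProg
  /-- while `reg x ≠ 0`, run `P` -/
  | loop (x : ℕ) (P : RamProg) : RamProg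

/-- `RamExec W P s t s'`: started in configuration `s`, the program `P` halts in configuration `s'`
after exactly `t` steps, and no constant and no sum that is computed exceeds the word bound `W`.
Under the uniform cost measure each instruction and each test takes one step. -/
inductive RamExec (W : ℕ) : RamProg → RamState → ℕ → RamState → Prop
  | skip (s : RamState) : RamExec W .skip s 1 s
  | const (s : RamState) (x c : ℕ) (h : c ≤ W) : RamExec W (.const x c) s 1 (s.setReg x c)
  | add (s : RamState) (x y z : ℕ) (h : s.reg y + s.reg z ≤ W) :
      RamExec W (.add x y z) s 1 (s.setReg x (s.reg y + s.reg z))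
  | sub (s : RamState) (x y z : ℕ) : RamExec W (.sub x y z) s 1 (s.setReg x (s.reg y - s.reg z))
  | load (s : RamState) (x a y : ℕ) :
      RamExec W (.load x a y) s 1 (s.setReg x (s.arr a (s.reg y)))
  | store (s : RamState) (a x y : ℕ) :
      RamExec W (.store a x y) s 1 (s.setArr a (s.reg x) (s.reg y))
  | seq {P P' : RamProg} {s s₁ s₂ : RamState} {t t' : ℕ}
      (h : RamExec W P s t s₁) (h' : RamExec W P' s₁ t' s₂) : RamExec W (.seq P P') s (t + t') s₂
  | cond_true {x : ℕ} {P P' : RamProg} {s s₁ : RamState} {t : ℕ} (hx : s.reg x ≠ 0)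
      (h : RamExec W P s t s₁) : RamExec W (.cond x P P') s (t + 1) s₁
  | cond_false {x : ℕ} {P P' : RamProg} {s s₁ : RamState} {t : ℕ} (hx : s.reg x = 0)
      (h : RamExec W P' s t s₁) : RamExec W (.cond x P P') s (t + 1) s₁
  | loop_true {x : ℕ} {P : RamProg} {s s₁ s₂ : RamState} {t t' : ℕ} (hx : s.reg x ≠ 0)
      (h : RamExec W P s t s₁) (h' : RamExec W (.loop x P) s₁ t' s₂) :
      RamExec W (.loop x P) s (t + t' + 1) s₂
  | loop_false {x : ℕ} {P : RamProg} {s : RamState} (hx : s.reg x = 0) :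
      RamExec W (.loop x P) s 1 s

/-- Array `0` holds the first children of the nodes of a tree and array `1` the second children: the
entry is `u + 1` if the child is `u`, and it is `0` at a leaf. -/
def RamState.HoldsShape (s : RamState) : BinTree → Prop
  | .leaf v => s.arr 0 v = 0 ∧ s.arr 1 v = 0
  | .node v l r => s.arr 0 v = l.root + 1 ∧ s.arr 1 v = r.root + 1 ∧
      s.HoldsShape l ∧ s.HoldsShape r

/-- The configuration `s` holds the labeled tree `(T, lam)`: its size is in register `0`, its root in
register `1`, its child pointers are in the arrays `0` and `1`, and the array `2 + l` is the
characteristic function of the set of nodes that carry the label `l`. -/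
def RamState.Holds {k : ℕ} (s : RamState) (T : BinTree) (lam : Labeling k) : Prop :=
  s.reg 0 = T.size ∧ s.reg 1 = T.root ∧ s.HoldsShape T ∧
    ∀ v ∈ T.nodes, ∀ l : Fin k, s.arr (2 + l) v = if l ∈ lam v then 1 else 0

/-- `s` is the initial configuration for the input `(T, lam)`: it holds this labeled tree, and
everything else is `0`. -/
def RamState.IsInput {k : ℕ} (s : RamState) (T : BinTree) (lam : Labeling k) : Prop :=
  s.Holds T lam ∧ (∀ x, 2 ≤ x → s.reg x = 0) ∧
    ∀ a v, (2 + k ≤ a ∨ v ∉ T.nodes) → s.arr a v = 0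

/-! The tree `T` is balanced by parallel tree contraction. At first every node is a cluster of its
own. In a round, processed bottom-up, a node absorbs both its children whenever neither child has
absorbed anything in this round and at least one of them is a leaf of the current tree; the
grandchildren below the other child become its new children. The new cluster is `comb a sd P L S`:
`P` is the absorbing cluster, `L` the leaf and `S` the other child. It is represented in the
balanced tree by two fresh nodes, `a` with children `a + 1` and `S`, and `a + 1` with children `P`
and `L`. The contraction ends with one cluster, whose tree is `T'`. Its leaves are the nodes of `T`,
so a relabeling of `T` is literally the same relabeling of `T'`.

Height: a round turns a non-leaf tree with `w` leaves into one with at most `3w/4`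
(`leaves_round_le`) and increases the height of the clusters by at most 2 (`height_round`), because
only clusters that are unchanged in this round are combined. Since `(3/4)^3 < 1/2`, `3 * log` rounds
suffice (`isLeaf_iterate`), and the height is at most `6 * log`.

Query: the topmost node of a cluster is the leftmost leaf of its tree, and the port, where further
clusters hang, is the rightmost leaf. Every edge of `T` becomes internal to a cluster at exactly one
kind of place: at a combination, it leads from the port of `P` to the top of `L` or of `S`. Two new
labels on the upper nodes `a` record whether `L` is the first or the second child. Hence both child
relations of `T` are MSO-definable on the leaves of `T'` (`edge_iff_edgeRel`), and replacing them by
their definitions and relativizing to leaves gives `Q'` (`Interprets.answers_eq`). On Gödel numbers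
this substitution is primitive recursive (`computable_translate`).

Time: a round costs a constant times the current number of nodes, which shrinks geometrically, so
the total is linear (`RamInv.loop`). A round lists the nodes in preorder with a stack and then
treats the list backwards, so that children precede parents. The registers 0, 1, 2 hold the size,
the root and the least unused identifier, 5 and 7 the constants 0 and 1; the arrays `k + 2` and `k +
3` hold the two new labels, `k + 4` the offsets from nodes to the roots of their clusters, `k + 5`
the absorption flags, `k + 6` the list and `k + 7` the stack. -/

/-! ### Interpreting a tree in the leaves of another tree -/

namespace MSO

variable {k p m : ℕ}

/-- `x` is a leaf. -/
def isLeaf (x : Fin p) : MSO k p m := neg (ex1 (child1 x.succ 0))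

/-- `φ` or `ψ`. -/
def disj (φ ψ : MSO k p m) : MSO k p m := neg (conj (neg φ) (neg ψ))

/-- `y` is reached from `x` by going to first children. -/
def reach1 (x y : Fin p) : MSO k p m :=
  neg (ex2 (conj (mem x 0) (conj (neg (mem y 0)) (neg (ex1 (ex1 (conj (mem (Fin.succ 0) 0)
    (conj (neg (mem 0 0)) (child1 (Fin.succ 0) 0)))))))))

/-- `y` is reached from `x` by going to second children. -/
def reach2 (x y : Fin p) : MSO k p m :=
  neg (ex2 (conj (mem x 0) (conj (neg (mem y 0)) (neg (ex1 (ex1 (conj (mem (Fin.succ 0) 0)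
    (conj (neg (mem 0 0)) (child2 (Fin.succ 0) 0)))))))))

/-- There is a node `a` with second child `s`, whose first child `b` has the children `q` and `r`,
such that going to second children leads from `q` to `x` and going to first children leads to `y`
from `r` if `a` carries the label `la`, or from `s` if `a` carries the label `lb`. -/
def edgeFormula (la lb : Fin k) (x y : Fin p) : MSO k p m :=
  ex1 (ex1 (ex1 (ex1 (conj (child1 (Fin.succ (Fin.succ (Fin.succ 0))) (Fin.succ (Fin.succ 0)))
    (conj (child1 (Fin.succ (Fin.succ 0)) (Fin.succ 0))
    (conj (reach2 (Fin.succ 0) x.succ.succ.succ.succ)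
    (conj (reach1 0 y.succ.succ.succ.succ)
      (disj (conj (label la (Fin.succ (Fin.succ (Fin.succ 0)))) (child2 (Fin.succ (Fin.succ 0)) 0))
        (conj (label lb (Fin.succ (Fin.succ (Fin.succ 0))))
          (child2 (Fin.succ (Fin.succ (Fin.succ 0))) 0))))))))))

/-- Replace the child relations by edge formulas, and let first-order quantifiers range over leaves. -/
def interp : {p m : ℕ} → MSO k p m → MSO (k + 2) p m
  | _, _, eq x y => eq x y
  | _, _, child1 x y => edgeFormula ⟨k, by omega⟩ ⟨k + 1, by omega⟩ x y
  | _, _, child2 x y => edgeFormula ⟨k + 1, by omega⟩ ⟨k, by omega⟩ x y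
  | _, _, label l x => label (l.castLE (by omega)) x
  | _, _, mem x X => mem x X
  | _, _, neg φ => neg φ.interp
  | _, _, conj φ ψ => conj φ.interp ψ.interp
  | _, _, ex1 φ => ex1 (conj (isLeaf 0) φ.interp)
  | _, _, ex2 φ => ex2 φ.interp

/-- All members of `X` are leaves. -/
def subLeaf (X : Fin m) : MSO k p m := neg (ex1 (conj (mem 0 X) (neg (isLeaf 0))))

/-- `φ`, and the first `i` first-order variables are leaves. -/
def guard1 (φ : MSO k p m) : (i : ℕ) → i ≤ p → MSO k p m
  | 0, _ => φ
  | i + 1, h => conj (isLeaf ⟨i, h⟩) (guard1 φ i (by omega))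

/-- `φ`, and the first `j` second-order variables are sets of leaves. -/
def guard2 (φ : MSO k p m) : (j : ℕ) → j ≤ m → MSO k p m
  | 0, _ => φ
  | j + 1, h => conj (subLeaf ⟨j, h⟩) (guard2 φ j (by omega))

/-- The query on the balanced tree. -/
def translate (Q : MSO k p m) : MSO (k + 2) p m :=
  guard2 (guard1 Q.interp p le_rfl) m le_rfl

end MSO

/-! ### Semantics of the translated query -/

namespace BinTree

theorem Child1.mem_nodes {T : BinTree} {u v : ℕ} (h : T.Child1 u v) : u ∈ T.nodes ∧ v ∈ T.nodes := by
  induction T with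
  | leaf w => exact h.elim
  | node w l r ihl ihr =>
    rcases h with ⟨rfl, rfl⟩ | h | h
    · cases l <;> simp [nodes, root]
    · have := ihl h; simp [nodes, this]
    · have := ihr h; simp [nodes, this]

theorem Child2.mem_nodes {T : BinTree} {u v : ℕ} (h : T.Child2 u v) : u ∈ T.nodes ∧ v ∈ T.nodes := by
  induction T with
  | leaf w => exact h.elim
  | node w l r ihl ihr =>
    rcases h with ⟨rfl, rfl⟩ | h | h
    · cases r <;> simp [nodes, root]
    · have := ihl h; simp [nodes, this]
    · have := ihr h; simp [nodes, this]

end BinTree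

namespace MSO

variable {k p m : ℕ} {T : BinTree} {lam : Labeling k}

theorem sat_disj {φ ψ : MSO k p m} {a B} :
    (disj φ ψ).Sat T lam a B ↔ φ.Sat T lam a B ∨ ψ.Sat T lam a B := by
  simp only [disj, Sat]; tauto

theorem sat_isLeaf {x : Fin p} {a : Fin p → ℕ} {B : Fin m → Set ℕ} :
    (isLeaf x).Sat T lam a B ↔ ∀ v, ¬ T.Child1 (a x) v := by
  simp only [isLeaf, Sat, Fin.cons_succ, Fin.cons_zero, not_exists, not_and]
  exact ⟨fun h v hv => h v hv.mem_nodes.2 hv, fun h v _ => h v⟩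

/-- The standard MSO definition of reachability: `v` lies in every set that contains `u` and is
closed under `R`. The hypotheses keep the set of reachable nodes inside the tree, as the set
quantifier requires. -/
theorem exists_closed_iff {R : ℕ → ℕ → Prop} (hR : ∀ {u v}, R u v → v ∈ T.nodes) {u v : ℕ}
    (hu : u ∈ T.nodes) :
    (¬ ∃ S : Set ℕ, (∀ v ∈ S, v ∈ T.nodes) ∧ u ∈ S ∧ v ∉ S ∧
      ¬ ∃ x ∈ T.nodes, ∃ y ∈ T.nodes, x ∈ S ∧ y ∉ S ∧ R x y) ↔ Relation.ReflTransGen R u v := by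
  constructor
  · intro h
    by_contra hv
    refine h ⟨{w | Relation.ReflTransGen R u w}, ?_, .refl, hv, ?_⟩
    · intro w hw
      rcases Relation.ReflTransGen.cases_tail hw with rfl | ⟨z, _, hz⟩
      exacts [hu, hR hz]
    · rintro ⟨x, _, y, _, hx, hy, hxy⟩
      exact hy (Relation.ReflTransGen.tail hx hxy)
  · rintro h ⟨S, hS, hu', hv, hcl⟩
    apply hv
    clear hv
    induction h with
    | refl => exact hu'
    | tail _ hyz ih =>
      by_contra hz
      exact hcl ⟨_, hS _ ih, _, hR hyz, ih, hz, hyz⟩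

theorem sat_reach1 {x y : Fin p} {a : Fin p → ℕ} {B : Fin m → Set ℕ} (hx : a x ∈ T.nodes) :
    (reach1 x y).Sat T lam a B ↔ Relation.ReflTransGen T.Child1 (a x) (a y) := by
  rw [← exists_closed_iff (fun h => h.mem_nodes.2) hx]
  simp only [reach1, Sat, Fin.cons_succ, Fin.cons_zero]

theorem sat_reach2 {x y : Fin p} {a : Fin p → ℕ} {B : Fin m → Set ℕ} (hx : a x ∈ T.nodes) :
    (reach2 x y).Sat T lam a B ↔ Relation.ReflTransGen T.Child2 (a x) (a y) := by
  rw [← exists_closed_iff (fun h => h.mem_nodes.2) hx]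
  simp only [reach2, Sat, Fin.cons_succ, Fin.cons_zero]

/-- The relation that is expressed by `edgeFormula`. -/
def EdgeRel (T : BinTree) (A A' : ℕ → Prop) (u v : ℕ) : Prop :=
  ∃ a b q w, T.Child1 a b ∧ T.Child1 b q ∧ Relation.ReflTransGen T.Child2 q u ∧
    Relation.ReflTransGen T.Child1 w v ∧ (A a ∧ T.Child2 b w ∨ A' a ∧ T.Child2 a w)

theorem sat_edgeFormula {la lb : Fin k} {x y : Fin p} {a : Fin p → ℕ} {B : Fin m → Set ℕ} :
    (edgeFormula la lb x y).Sat T lam a B ↔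
      EdgeRel T (fun v => la ∈ lam v) (fun v => lb ∈ lam v) (a x) (a y) := by
  simp only [edgeFormula, Sat, EdgeRel, sat_disj, Fin.cons_succ, Fin.cons_zero]
  constructor
  · rintro ⟨a', ha, b, hb, q, hq, w, hw, h1, h2, h3, h4, h5⟩
    rw [sat_reach2 (by simpa using hq)] at h3
    rw [sat_reach1 (by simpa using hw)] at h4
    exact ⟨a', b, q, w, h1, h2, by simpa using h3, by simpa using h4, h5⟩
  · rintro ⟨a', b, q, w, h1, h2, h3, h4, h5⟩
    have hw : w ∈ T.nodes := by
      rcases h5 with h | h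
      exacts [h.2.mem_nodes.2, h.2.mem_nodes.2]
    refine ⟨a', h1.mem_nodes.1, b, h1.mem_nodes.2, q, h2.mem_nodes.2, w, hw, h1, h2, ?_, ?_, h5⟩
    · rw [sat_reach2 (by simpa using h2.mem_nodes.2)]
      simpa using h3
    · rw [sat_reach1 (by simpa using hw)]
      simpa using h4

theorem sat_guard1 {φ : MSO k p m} {a : Fin p → ℕ} {B : Fin m → Set ℕ} (i : ℕ) (hi : i ≤ p) :
    (guard1 φ i hi).Sat T lam a B ↔
      (∀ x : Fin p, x < i → ∀ v, ¬ T.Child1 (a x) v) ∧ φ.Sat T lam a B := by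
  induction i with
  | zero => simp [guard1]
  | succ i ih =>
    simp only [guard1, Sat, sat_isLeaf, ih, ← and_assoc]
    refine and_congr_left fun _ => ⟨fun h x hx => ?_, fun h => ⟨h _ (Nat.lt_succ_self i),
      fun x hx => h x (by omega)⟩⟩
    rcases Nat.lt_succ_iff_lt_or_eq.1 hx with hx | hx
    · exact h.2 x hx
    · convert h.1

theorem sat_subLeaf {X : Fin m} {a : Fin p → ℕ} {B : Fin m → Set ℕ} :
    (subLeaf X).Sat T lam a B ↔ ∀ v ∈ T.nodes, v ∈ B X → ∀ w, ¬ T.Child1 v w := by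
  simp only [subLeaf, Sat, sat_isLeaf, Fin.cons_zero]
  push Not
  rfl

theorem sat_guard2 {φ : MSO k p m} {a : Fin p → ℕ} {B : Fin m → Set ℕ} (j : ℕ) (hj : j ≤ m) :
    (guard2 φ j hj).Sat T lam a B ↔
      (∀ X : Fin m, X < j → ∀ v ∈ T.nodes, v ∈ B X → ∀ w, ¬ T.Child1 v w) ∧ φ.Sat T lam a B := by
  induction j with
  | zero => simp [guard2]
  | succ i ih =>
    simp only [guard2, Sat, sat_subLeaf, ih, ← and_assoc]
    refine and_congr_left fun _ => ⟨fun h x hx => ?_, fun h => ⟨h _ (Nat.lt_succ_self i),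
      fun x hx => h x (by omega)⟩⟩
    rcases Nat.lt_succ_iff_lt_or_eq.1 hx with hx | hx
    · exact h.2 x hx
    · convert h.1

/-- `(T', lam')` interprets `(T, lam)` in its leaves. -/
structure Interprets (T' : BinTree) (lam' : Labeling (k + 2)) (T : BinTree) (lam : Labeling k) :
    Prop where
  mem_iff : ∀ v, v ∈ T.nodes ↔ v ∈ T'.nodes ∧ ∀ w, ¬ T'.Child1 v w
  label_iff : ∀ v ∈ T.nodes, ∀ l : Fin k, l.castLE (by omega) ∈ lam' v ↔ l ∈ lam v
  child1_iff : ∀ u ∈ T.nodes, ∀ v ∈ T.nodes, T.Child1 u v ↔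
    EdgeRel T' (fun v => ⟨k, by omega⟩ ∈ lam' v) (fun v => ⟨k + 1, by omega⟩ ∈ lam' v) u v
  child2_iff : ∀ u ∈ T.nodes, ∀ v ∈ T.nodes, T.Child2 u v ↔
    EdgeRel T' (fun v => ⟨k + 1, by omega⟩ ∈ lam' v) (fun v => ⟨k, by omega⟩ ∈ lam' v) u v

/-- Set quantifiers need no relativization: membership is only ever tested for first-order
variables, which range over leaves, so members of a set that are inner nodes have no influence. This
is why the two interpretations of the set variables are only required to agree on the nodes of `T`.
-/
theorem Interprets.sat_iff {T' : BinTree} {lam' : Labeling (k + 2)} (h : Interprets T' lam' T lam)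
    (φ : MSO k p m) (a : Fin p → ℕ) (B B' : Fin m → Set ℕ) (ha : ∀ x, a x ∈ T.nodes)
    (hB : ∀ X, ∀ v ∈ T.nodes, v ∈ B' X ↔ v ∈ B X) :
    φ.interp.Sat T' lam' a B' ↔ φ.Sat T lam a B := by
  induction φ with
  | eq x y => exact Iff.rfl
  | child1 x y => simpa only [interp, sat_edgeFormula, Sat] using (h.child1_iff _ (ha x) _ (ha y)).symm
  | child2 x y => simpa only [interp, sat_edgeFormula, Sat] using (h.child2_iff _ (ha x) _ (ha y)).symm
  | label l x => exact h.label_iff _ (ha x) l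
  | mem x X => exact hB X _ (ha x)
  | neg φ ih => exact not_congr (ih a B B' ha hB)
  | conj φ ψ ih ih' => exact and_congr (ih a B B' ha hB) (ih' a B B' ha hB)
  | ex1 φ ih =>
    simp only [interp, Sat, sat_isLeaf, Fin.cons_zero]
    constructor
    · rintro ⟨v, hv, hl, hs⟩
      have hv' := (h.mem_iff v).2 ⟨hv, hl⟩
      refine ⟨v, hv', (ih _ B B' ?_ hB).1 hs⟩
      exact Fin.cases hv' ha
    · rintro ⟨v, hv, hs⟩
      obtain ⟨hv1, hv2⟩ := (h.mem_iff v).1 hv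
      refine ⟨v, hv1, hv2, (ih _ B B' ?_ hB).2 hs⟩
      exact Fin.cases hv ha
  | ex2 φ ih =>
    simp only [interp, Sat]
    constructor
    · rintro ⟨S, hS, hs⟩
      -- A set of nodes of `T'` may contain inner nodes; only its trace on the leaves is kept.
      refine ⟨{v ∈ S | v ∈ T.nodes}, fun v hv => hv.2, (ih a _ _ ha ?_).1 hs⟩
      refine Fin.cases ?_ ?_
      · intro v hv; simp [hv]
      · exact hB
    · rintro ⟨S, hS, hs⟩
      refine ⟨S, fun v hv => ((h.mem_iff v).1 (hS v hv)).1, (ih a _ _ ha ?_).2 hs⟩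
      refine Fin.cases ?_ ?_
      · intro v hv; simp
      · exact hB

/-- Unlike bound set variables, free ones must be guarded: otherwise answers that differ only in
inner nodes of `T'` would be added. -/
theorem Interprets.answers_eq {T' : BinTree} {lam' : Labeling (k + 2)}
    (h : Interprets T' lam' T lam) (Q : MSO k p m) :
    Q.translate.answers T' lam' = Q.answers T lam := by
  ext ⟨a, B⟩
  simp only [answers, translate, Set.mem_ofPred_eq, sat_guard1, sat_guard2]
  constructor
  · rintro ⟨h1, h2, h3, h4, h5⟩
    have ha : ∀ x, a x ∈ T.nodes := fun x => (h.mem_iff _).2 ⟨h1 x, h4 x x.2⟩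
    exact ⟨ha, fun j v hv => (h.mem_iff _).2 ⟨h2 j v hv, h3 j j.2 v (h2 j v hv) hv⟩,
      (h.sat_iff Q a B B ha fun _ _ _ => Iff.rfl).1 h5⟩
  · rintro ⟨h1, h2, h3⟩
    exact ⟨fun x => ((h.mem_iff _).1 (h1 x)).1, fun j v hv => ((h.mem_iff _).1 (h2 j v hv)).1,
      fun j _ v _ hv => ((h.mem_iff _).1 (h2 j v hv)).2, fun x _ => ((h.mem_iff _).1 (h1 x)).2,
      (h.sat_iff Q a B B h1 fun _ _ _ => Iff.rfl).2 h3⟩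

end MSO

/-! ### The translation of queries is computable -/

namespace QueryCode

/-- The code of `MSO.isLeaf`. -/
def isLeaf (x : ℕ) : ℕ := Nat.pair 5 (Nat.pair 7 (Nat.pair 1 (Nat.pair (x + 1) 0)))

/-- The code of `MSO.disj`. -/
def disj (a b : ℕ) : ℕ := Nat.pair 5 (Nat.pair 6 (Nat.pair (Nat.pair 5 a) (Nat.pair 5 b)))

/-- The code of `MSO.reach1` (for `i = 1`) and of `MSO.reach2` (for `i = 2`). -/
def reach (i x y : ℕ) : ℕ :=
  Nat.pair 5 (Nat.pair 8 (Nat.pair 6 (Nat.pair (Nat.pair 4 (Nat.pair x 0)) (Nat.pair 6 (Nat.pair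
    (Nat.pair 5 (Nat.pair 4 (Nat.pair y 0))) (Nat.pair 5 (Nat.pair 7 (Nat.pair 7 (Nat.pair 6
    (Nat.pair (Nat.pair 4 (Nat.pair 1 0)) (Nat.pair 6 (Nat.pair (Nat.pair 5 (Nat.pair 4
    (Nat.pair 0 0))) (Nat.pair i (Nat.pair 1 0))))))))))))))

/-- The code of `MSO.edgeFormula`. -/
def edge (la lb x y : ℕ) : ℕ :=
  Nat.pair 7 (Nat.pair 7 (Nat.pair 7 (Nat.pair 7 (Nat.pair 6 (Nat.pair
    (Nat.pair 1 (Nat.pair 3 2)) (Nat.pair 6 (Nat.pair (Nat.pair 1 (Nat.pair 2 1))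
    (Nat.pair 6 (Nat.pair (reach 2 1 (x + 4)) (Nat.pair 6 (Nat.pair (reach 1 0 (y + 4))
    (disj (Nat.pair 6 (Nat.pair (Nat.pair 3 (Nat.pair la 3)) (Nat.pair 2 (Nat.pair 2 0))))
      (Nat.pair 6 (Nat.pair (Nat.pair 3 (Nat.pair lb 3)) (Nat.pair 2 (Nat.pair 3 0))))))))))))))))

/-- One step of the translation of codes: `n` is the code of a formula, and `f` translates the codes
of its subformulas. -/
def interpStep (k n : ℕ) (f : ℕ → ℕ) : ℕ :=
  if n.unpair.1 = 1 then edge k (k + 1) n.unpair.2.unpair.1 n.unpair.2.unpair.2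
  else if n.unpair.1 = 2 then edge (k + 1) k n.unpair.2.unpair.1 n.unpair.2.unpair.2
  else if n.unpair.1 = 5 then Nat.pair 5 (f n.unpair.2)
  else if n.unpair.1 = 6 then
    Nat.pair 6 (Nat.pair (f n.unpair.2.unpair.1) (f n.unpair.2.unpair.2))
  else if n.unpair.1 = 7 then Nat.pair 7 (Nat.pair 6 (Nat.pair (isLeaf 0) (f n.unpair.2)))
  else if n.unpair.1 = 8 then Nat.pair 8 (f n.unpair.2)
  else n

/-- The translation of codes that corresponds to `MSO.interp`. -/
def interp (k n : ℕ) : ℕ := interpStep k n fun r => if r < n then interp k r else 0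

/-- The translation of codes that corresponds to `MSO.guard1`. -/
def guard1 (n : ℕ) : ℕ → ℕ :=
  Nat.rec n fun i c => Nat.pair 6 (Nat.pair (isLeaf i) c)

/-- The code of `MSO.subLeaf`. -/
def subLeaf (X : ℕ) : ℕ :=
  Nat.pair 5 (Nat.pair 7 (Nat.pair 6 (Nat.pair (Nat.pair 4 (Nat.pair 0 X))
    (Nat.pair 5 (isLeaf 0)))))

/-- The translation of codes that corresponds to `MSO.guard2`. -/
def guard2 (n : ℕ) : ℕ → ℕ :=
  Nat.rec n fun j c => Nat.pair 6 (Nat.pair (subLeaf j) c)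

/-- The translation of codes that corresponds to `MSO.translate`. -/
def translate (n : ℕ) : ℕ :=
  Nat.pair (n.unpair.1 + 2) (Nat.pair n.unpair.2.unpair.1 (Nat.pair n.unpair.2.unpair.2.unpair.1
    (guard2 (guard1 (interp n.unpair.1 n.unpair.2.unpair.2.unpair.2) n.unpair.2.unpair.1)
      n.unpair.2.unpair.2.unpair.1)))

end QueryCode

namespace MSO

variable {k p m : ℕ}

theorem code_isLeaf (x : Fin p) : (isLeaf x : MSO k p m).code = QueryCode.isLeaf x := by
  simp only [isLeaf, code, QueryCode.isLeaf, Fin.val_succ, Fin.val_zero]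

theorem code_reach1 (x y : Fin p) : (reach1 x y : MSO k p m).code = QueryCode.reach 1 x y := by
  simp only [reach1, code, QueryCode.reach, Fin.val_succ, Fin.val_zero, zero_add]

theorem code_reach2 (x y : Fin p) : (reach2 x y : MSO k p m).code = QueryCode.reach 2 x y := by
  simp only [reach2, code, QueryCode.reach, Fin.val_succ, Fin.val_zero, zero_add]

theorem code_edgeFormula (la lb : Fin k) (x y : Fin p) :
    (edgeFormula la lb x y : MSO k p m).code = QueryCode.edge la lb x y := by
  simp only [edgeFormula, disj, code, code_reach1, code_reach2, QueryCode.edge, QueryCode.disj,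
    Fin.val_succ, Fin.val_zero, zero_add, add_assoc, Nat.reduceAdd]

theorem code_interp (φ : MSO k p m) : φ.interp.code = QueryCode.interp k φ.code := by
  -- The recursion on codes only calls itself below its argument. The tags of the formulas with
  -- subformulas are positive, so the codes of subformulas are strictly smaller and this guard is
  -- met.
  have lt (i a : ℕ) (h : 0 < i) : a < Nat.pair i a := by
    have := Nat.add_le_pair i a
    omega
  have lt1 (i a b : ℕ) (h : 0 < i) : a < Nat.pair i (Nat.pair a b) :=
    (Nat.left_le_pair a b).trans_lt (lt _ _ h)
  have lt2 (i a b : ℕ) (h : 0 < i) : b < Nat.pair i (Nat.pair a b) :=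
    (Nat.right_le_pair a b).trans_lt (lt _ _ h)
  induction φ <;> rw [QueryCode.interp] <;>
    simp [interp, code, QueryCode.interpStep, code_edgeFormula, code_isLeaf, *]

theorem code_guard1 (φ : MSO k p m) (i : ℕ) (hi : i ≤ p) :
    (guard1 φ i hi).code = QueryCode.guard1 φ.code i := by
  induction i with
  | zero => rfl
  | succ i ih => simp only [guard1, code, code_isLeaf, ih, QueryCode.guard1]

theorem code_guard2 (φ : MSO k p m) (j : ℕ) (hj : j ≤ m) :
    (guard2 φ j hj).code = QueryCode.guard2 φ.code j := by
  induction j with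
  | zero => rfl
  | succ i ih =>
    simp only [guard2, subLeaf, code, code_isLeaf, ih, QueryCode.guard2, QueryCode.subLeaf,
      Fin.val_zero]

theorem queryCode_translate (Q : MSO k p m) :
    Q.translate.queryCode = QueryCode.translate Q.queryCode := by
  simp [queryCode, translate, QueryCode.translate, code_guard1, code_guard2, code_interp]

end MSO

/-! ### Primitive recursiveness of the translation of codes -/

namespace QueryCode

open Primrec

variable {α : Type*} [Primcodable α] {f g h i : α → ℕ}

theorem primrec_pair (hf : Primrec f) (hg : Primrec g) : Primrec fun a => Nat.pair (f a) (g a) :=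
  Primrec₂.natPair.comp hf hg

theorem primrec_add_const (hf : Primrec f) (n : ℕ) : Primrec fun a => f a + n :=
  Primrec.nat_add.comp hf (const n)

theorem primrec_isLeaf (hf : Primrec f) : Primrec fun a => isLeaf (f a) := by
  unfold isLeaf
  repeat' with_reducible first | exact hf | apply primrec_pair | apply primrec_add_const | exact const _

theorem primrec_edge (hf : Primrec f) (hg : Primrec g) (hh : Primrec h) (hi : Primrec i) :
    Primrec fun a => edge (f a) (g a) (h a) (i a) := by
  unfold edge disj reach
  repeat' with_reducible first
    | exact hf | exact hg | exact hh | exact hi | exact const _ | apply primrec_pair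
    | apply primrec_add_const

theorem primrec_unpair_fst (hf : Primrec f) : Primrec fun a => (f a).unpair.1 :=
  fst.comp (Primrec.unpair.comp hf)

theorem primrec_unpair_snd (hf : Primrec f) : Primrec fun a => (f a).unpair.2 :=
  snd.comp (Primrec.unpair.comp hf)

theorem primrec_interpStep {F : α → ℕ → ℕ} (hf : Primrec f) (hg : Primrec g) (hF : Primrec₂ F) :
    Primrec fun a => interpStep (f a) (g a) (F a) := by
  have hF' {j : α → ℕ} (hj : Primrec j) : Primrec fun a => F a (j a) := hF.comp Primrec.id hj
  have heq (n : ℕ) : PrimrecPred fun a => (g a).unpair.1 = n :=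
    Primrec.eq.comp (primrec_unpair_fst hg) (const n)
  unfold interpStep
  refine Primrec.ite (heq _) ?_ (Primrec.ite (heq _) ?_ (Primrec.ite (heq _) ?_
    (Primrec.ite (heq _) ?_ (Primrec.ite (heq _) ?_ (Primrec.ite (heq _) ?_ hg)))))
  all_goals
    repeat' with_reducible first
      | exact hf | exact hg | exact const _ | apply primrec_edge | apply primrec_pair
      | apply primrec_add_const | apply hF' | apply primrec_unpair_fst | apply primrec_unpair_snd

/-- Course-of-values recursion: the list `IH` of the values below `n` has length `n`, which recovers
the argument, and reading it beyond its end yields the same default 0 as the guard in `interp`. -/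
theorem primrec_interp : Primrec₂ interp := by
  refine Primrec.nat_strong_rec interp
    (g := fun k IH => some (interpStep k IH.length fun r => (IH[r]?).getD 0)) ?_ ?_
  · refine Primrec.option_some.comp (primrec_interpStep fst (list_length.comp snd) ?_)
    exact Primrec.option_getD.comp (list_getElem?.comp (snd.comp fst) snd) (const 0)
  · intro k n
    rw [interp, List.length_map, List.length_range]
    congr 2
    funext r
    by_cases h : r < n <;> simp [h]

theorem primrec_guard1 (hf : Primrec f) (hg : Primrec g) :
    Primrec fun a => guard1 (f a) (g a) :=
  nat_rec' hg hf (primrec_pair (const 6) (primrec_pair (primrec_isLeaf (fst.comp snd))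
    (snd.comp snd))).to₂

theorem primrec_subLeaf (hf : Primrec f) : Primrec fun a => subLeaf (f a) := by
  unfold subLeaf
  repeat' with_reducible first
    | exact hf | exact const _ | apply primrec_pair

theorem primrec_guard2 (hf : Primrec f) (hg : Primrec g) :
    Primrec fun a => guard2 (f a) (g a) :=
  nat_rec' hg hf (primrec_pair (const 6) (primrec_pair (primrec_subLeaf (fst.comp snd))
    (snd.comp snd))).to₂

theorem computable_translate : Computable translate := by
  have hid : Primrec fun n : ℕ => n := Primrec.id
  refine Primrec.to_comp ?_
  unfold translate
  repeat' with_reducible first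
    | exact hid | exact const _ | apply primrec_pair | apply primrec_add_const
    | apply primrec_guard2 | apply primrec_guard1 | apply primrec_interp.comp
    | apply primrec_unpair_fst | apply primrec_unpair_snd

end QueryCode

/-! ### Subtrees -/

namespace BinTree

/-- `t` is a subtree of the given tree. -/
def Sub (t : BinTree) : BinTree → Prop
  | leaf v => t = leaf v
  | node v l r => t = node v l r ∨ t.Sub l ∨ t.Sub r

/-- The leaf that is reached from the root by going to first children. -/
def leftmost : BinTree → ℕ
  | leaf v => v
  | node _ l _ => l.leftmost

/-- The leaf that is reached from the root by going to second children. -/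
def rightmost : BinTree → ℕ
  | leaf v => v
  | node _ _ r => r.rightmost

theorem Sub.refl (t : BinTree) : t.Sub t := by
  cases t
  · rfl
  · exact Or.inl rfl

theorem Sub.trans {t t' T : BinTree} (h : t.Sub t') (h' : t'.Sub T) : t.Sub T := by
  induction T with
  | leaf v => obtain rfl : t' = leaf v := h'; exact h
  | node v l r ihl ihr =>
    rcases h' with rfl | h' | h'
    · exact h
    · exact Or.inr (Or.inl (ihl h'))
    · exact Or.inr (Or.inr (ihr h'))

theorem Sub.left (v : ℕ) (l r : BinTree) : l.Sub (node v l r) := Or.inr (Or.inl (.refl l))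

theorem Sub.right (v : ℕ) (l r : BinTree) : r.Sub (node v l r) := Or.inr (Or.inr (.refl r))

theorem root_mem_nodes (t : BinTree) : t.root ∈ t.nodes := by
  cases t <;> simp [root, nodes]

theorem Sub.root_mem_nodes {t T : BinTree} (h : t.Sub T) : t.root ∈ T.nodes := by
  induction T with
  | leaf v => obtain rfl : t = leaf v := h; exact BinTree.root_mem_nodes _
  | node v l r ihl ihr =>
    rcases h with rfl | h | h
    · exact BinTree.root_mem_nodes _
    · simp [nodes, ihl h]
    · simp [nodes, ihr h]

/-- Distinct identifiers make a node determine its subtree. This makes the child relations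
functional and lets a marked node be decoded into a unique combination. -/
theorem Sub.eq_of_root_eq {t t' T : BinTree} (hT : T.nodes.Nodup) (h : t.Sub T) (h' : t'.Sub T)
    (he : t.root = t'.root) : t = t' := by
  induction T with
  | leaf v => exact Eq.trans h (Eq.symm h')
  | node v l r ihl ihr =>
    simp only [nodes, List.nodup_cons, List.mem_append, not_or, List.nodup_append] at hT
    obtain ⟨⟨hvl, hvr⟩, hl, hr, hlr⟩ := hT
    rcases h with rfl | h | h <;> rcases h' with rfl | h' | h'
    · rfl
    · exact (hvl ((show v = _ from he) ▸ h'.root_mem_nodes)).elim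
    · exact (hvr ((show v = _ from he) ▸ h'.root_mem_nodes)).elim
    · exact (hvl ((show _ = v from he) ▸ h.root_mem_nodes)).elim
    · exact ihl hl h h'
    · exact (hlr _ h.root_mem_nodes _ h'.root_mem_nodes he).elim
    · exact (hvr ((show _ = v from he) ▸ h.root_mem_nodes)).elim
    · exact (hlr _ h'.root_mem_nodes _ h.root_mem_nodes he.symm).elim
    · exact ihr hr h h'

theorem child1_iff {T : BinTree} {u v : ℕ} :
    T.Child1 u v ↔ ∃ l r, (node u l r).Sub T ∧ v = l.root := by
  induction T with
  | leaf w => simp [Child1, Sub]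
  | node w l r ihl ihr =>
    simp only [Child1, ihl, ihr, Sub, or_and_right, exists_or]
    refine or_congr_left ⟨?_, ?_⟩
    · rintro ⟨rfl, rfl⟩; exact ⟨l, r, rfl, rfl⟩
    · rintro ⟨l', r', h, rfl⟩; cases h; exact ⟨rfl, rfl⟩

theorem child2_iff {T : BinTree} {u v : ℕ} :
    T.Child2 u v ↔ ∃ l r, (node u l r).Sub T ∧ v = r.root := by
  induction T with
  | leaf w => simp [Child2, Sub]
  | node w l r ihl ihr =>
    simp only [Child2, ihl, ihr, Sub, or_and_right, exists_or]
    refine or_congr_left ⟨?_, ?_⟩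
    · rintro ⟨rfl, rfl⟩; exact ⟨l, r, rfl, rfl⟩
    · rintro ⟨l', r', h, rfl⟩; cases h; exact ⟨rfl, rfl⟩

theorem exists_sub {T : BinTree} {v : ℕ} (h : v ∈ T.nodes) : ∃ t : BinTree, t.Sub T ∧ t.root = v := by
  induction T with
  | leaf w => exact ⟨_, .refl _, (List.mem_singleton.1 h).symm⟩
  | node w l r ihl ihr =>
    simp only [nodes, List.mem_cons, List.mem_append] at h
    rcases h with rfl | h | h
    · exact ⟨_, .refl _, rfl⟩
    · obtain ⟨t, h1, h2⟩ := ihl h; exact ⟨t, Or.inr (Or.inl h1), h2⟩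
    · obtain ⟨t, h1, h2⟩ := ihr h; exact ⟨t, Or.inr (Or.inr h1), h2⟩

theorem Sub.child1 {T l r : BinTree} {v w : ℕ} (hT : T.nodes.Nodup) (h : (node v l r).Sub T) :
    T.Child1 v w ↔ w = l.root := by
  rw [child1_iff]
  refine ⟨?_, fun hw => ⟨l, r, h, hw⟩⟩
  rintro ⟨l', r', h', rfl⟩
  cases Sub.eq_of_root_eq hT h h' rfl
  rfl

theorem Sub.child2 {T l r : BinTree} {v w : ℕ} (hT : T.nodes.Nodup) (h : (node v l r).Sub T) :
    T.Child2 v w ↔ w = r.root := by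
  rw [child2_iff]
  refine ⟨?_, fun hw => ⟨l, r, h, hw⟩⟩
  rintro ⟨l', r', h', rfl⟩
  cases Sub.eq_of_root_eq hT h h' rfl
  rfl

theorem Sub.reach_leftmost {t T : BinTree} (h : t.Sub T) :
    Relation.ReflTransGen T.Child1 t.root t.leftmost := by
  induction t with
  | leaf v => exact .refl
  | node v l r ihl _ =>
    exact .head (child1_iff.2 ⟨l, r, h, rfl⟩) (ihl ((Sub.left v l r).trans h))

theorem Sub.reach_rightmost {t T : BinTree} (h : t.Sub T) :
    Relation.ReflTransGen T.Child2 t.root t.rightmost := by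
  induction t with
  | leaf v => exact .refl
  | node v l r _ ihr =>
    exact .head (child2_iff.2 ⟨l, r, h, rfl⟩) (ihr ((Sub.right v l r).trans h))

/-- First children are unique, so the path is forced, and it can end in a leaf only at the bottom.
The formulas merely express reachability; that the endpoint is a leaf comes from the guards. -/
theorem Sub.eq_leftmost {t T : BinTree} (hT : T.nodes.Nodup) (h : t.Sub T) {v : ℕ}
    (hv : ∀ w, ¬ T.Child1 v w) (hr : Relation.ReflTransGen T.Child1 t.root v) :
    v = t.leftmost := by
  induction t with
  | leaf u =>
    rcases Relation.ReflTransGen.cases_head hr with rfl | ⟨w, hw, _⟩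
    · rfl
    · obtain ⟨l, r, h', _⟩ := child1_iff.1 hw
      cases Sub.eq_of_root_eq hT h h' rfl
  | node u l r ihl _ =>
    rcases Relation.ReflTransGen.cases_head hr with rfl | ⟨w, hw, hr'⟩
    · exact (hv _ ((h.child1 hT).2 rfl)).elim
    · obtain rfl := (h.child1 hT).1 hw
      exact ihl ((Sub.left u l r).trans h) hr'

theorem Sub.eq_rightmost {t T : BinTree} (hT : T.nodes.Nodup) (h : t.Sub T) {v : ℕ}
    (hv : ∀ w, ¬ T.Child2 v w) (hr : Relation.ReflTransGen T.Child2 t.root v) :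
    v = t.rightmost := by
  induction t with
  | leaf u =>
    rcases Relation.ReflTransGen.cases_head hr with rfl | ⟨w, hw, _⟩
    · rfl
    · obtain ⟨l, r, h', _⟩ := child2_iff.1 hw
      cases Sub.eq_of_root_eq hT h h' rfl
  | node u l r _ ihr =>
    rcases Relation.ReflTransGen.cases_head hr with rfl | ⟨w, hw, hr'⟩
    · exact (hv _ ((h.child2 hT).2 rfl)).elim
    · obtain rfl := (h.child2 hT).1 hw
      exact ihr ((Sub.right u l r).trans h) hr'

theorem exists_child1_iff {T : BinTree} {v : ℕ} : (∃ w, T.Child1 v w) ↔ ∃ w, T.Child2 v w := by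
  simp only [child1_iff, child2_iff]
  exact ⟨fun ⟨_, l, r, h, _⟩ => ⟨_, l, r, h, rfl⟩, fun ⟨_, l, r, h, _⟩ => ⟨_, l, r, h, rfl⟩⟩

end BinTree

/-! ### Clusters -/

/-- A connected set of nodes of a tree, built from single nodes: `comb a sd P L S` consists of a
cluster `P`, of a cluster `L` whose top is a child of the port of `P` (the first child if `sd` is
true, and otherwise the second child), and of a cluster `S` whose top is the other child.  The
numbers `a` and `a + 1` identify the nodes of the balanced tree that stand for this combination. -/
inductive Cluster : Type
  | single (v : ℕ) : Cluster
  | comb (a : ℕ) (sd : Bool) (P L S : Cluster) : Cluster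

namespace Cluster

/-- The tree of the cluster. -/
def toTree : Cluster → BinTree
  | single v => .leaf v
  | comb a _ P L S => .node a (.node (a + 1) P.toTree L.toTree) S.toTree

/-- The topmost node. -/
def top : Cluster → ℕ
  | single v => v
  | comb _ _ P _ _ => P.top

/-- The node to which further clusters can be attached. -/
def port : Cluster → ℕ
  | single v => v
  | comb _ _ _ _ S => S.port

/-- `c.Edge i u v`: in the cluster `c`, the node `v` is the first (if `i` is true) or second (if `i`
is false) child of `u`. -/
def Edge (i : Bool) (u v : ℕ) : Cluster → Prop
  | single _ => False
  | comb _ sd P L S => P.Edge i u v ∨ L.Edge i u v ∨ S.Edge i u v ∨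
      u = P.port ∧ v = bif i == sd then L.top else S.top

/-- `v` is the upper node of a combination with the given side. -/
def Mark (sd : Bool) (v : ℕ) : Cluster → Prop
  | single _ => False
  | comb a sd' P L S => v = a ∧ sd' = sd ∨ P.Mark sd v ∨ L.Mark sd v ∨ S.Mark sd v

/-- Single nodes are below `n`; the other numbers are at least `n` and below `f`. -/
def InRange (n f : ℕ) : Cluster → Prop
  | single v => v < n
  | comb a _ P L S => n ≤ a ∧ a + 1 < f ∧ P.InRange n f ∧ L.InRange n f ∧ S.InRange n f

/-- The multiset of the nodes of the tree. -/
def ids : Cluster → Multiset ℕ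
  | single v => {v}
  | comb a _ P L S => {a} + {a + 1} + P.ids + L.ids + S.ids

/-! ### The tree of a cluster: leaves, ends and definability of edges -/

theorem coe_nodes_toTree (c : Cluster) : (c.toTree.nodes : Multiset ℕ) = c.ids := by
  induction c with
  | single v => rfl
  | comb a sd P L S ihP ihL ihS =>
    simp only [toTree, BinTree.nodes, ids, ← ihP, ← ihL, ← ihS, ← Multiset.cons_coe,
      ← Multiset.coe_add, ← Multiset.singleton_add]
    simp only [add_assoc]

theorem leftmost_toTree (c : Cluster) : c.toTree.leftmost = c.top := by
  induction c with
  | single v => rfl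
  | comb a sd P L S ihP ihL ihS => exact ihP

theorem rightmost_toTree (c : Cluster) : c.toTree.rightmost = c.port := by
  induction c with
  | single v => rfl
  | comb a sd P L S ihP ihL ihS => exact ihS

theorem InRange.mono {n f f' : ℕ} {c : Cluster} (h : c.InRange n f) (hf : f ≤ f') :
    c.InRange n f' := by
  induction c with
  | single v => exact h
  | comb a sd P L S ihP ihL ihS =>
    exact ⟨h.1, h.2.1.trans_le hf, ihP h.2.2.1, ihL h.2.2.2.1, ihS h.2.2.2.2⟩

theorem InRange.le_of_sub_node {n f v : ℕ} {c : Cluster} {l r : BinTree} (hc : c.InRange n f)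
    (h : (BinTree.node v l r).Sub c.toTree) : n ≤ v := by
  induction c with
  | single w => cases h
  | comb a sd P L S ihP ihL ihS =>
    obtain ⟨h1, h2, h3, h4, h5⟩ := hc
    rcases h with h | (h | h | h) | h
    · cases h; exact h1
    · cases h; omega
    · exact ihP h3 h
    · exact ihL h4 h
    · exact ihS h5 h

theorem InRange.lt_of_sub_leaf {n f v : ℕ} {c : Cluster} (hc : c.InRange n f)
    (h : (BinTree.leaf v).Sub c.toTree) : v < n := by
  induction c with
  | single w => cases h; exact hc
  | comb a sd P L S ihP ihL ihS =>
    obtain ⟨h1, h2, h3, h4, h5⟩ := hc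
    rcases h with h | (h | h | h) | h
    · cases h
    · cases h
    · exact ihP h3 h
    · exact ihL h4 h
    · exact ihS h5 h

theorem InRange.le_of_mark {n f v : ℕ} {sd : Bool} {c : Cluster} (hc : c.InRange n f)
    (h : c.Mark sd v) : n ≤ v := by
  induction c with
  | single w => exact h.elim
  | comb a sd P L S ihP ihL ihS =>
    obtain ⟨h1, h2, h3, h4, h5⟩ := hc
    rcases h with h | h | h | h
    exacts [h.1 ▸ h1, ihP h3 h, ihL h4 h, ihS h5 h]

/-- Leaves come from single nodes and inner nodes from fresh identifiers, so the numerical threshold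
`n` separates the old nodes from the new ones. -/
theorem InRange.lt_iff {n f v : ℕ} {c : Cluster} (hc : c.InRange n f) (h : v ∈ c.toTree.nodes) :
    v < n ↔ ∀ w, ¬ c.toTree.Child1 v w := by
  constructor
  · intro hv w hw
    obtain ⟨l, r, hs, _⟩ := BinTree.child1_iff.1 hw
    exact absurd (hc.le_of_sub_node hs) (by omega)
  · intro hv
    obtain ⟨t, ht, rfl⟩ := BinTree.exists_sub h
    cases t with
    | leaf v => exact hc.lt_of_sub_leaf ht
    | node v l r => exact (hv _ (BinTree.child1_iff.2 ⟨l, r, ht, rfl⟩)).elim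

/-- Each mark witnesses two edges, from the port of `P` to the tops of `L` and `S`;
`Edge.exists_sub` is the converse, that every edge arises from a mark. -/
theorem Mark.exists_sub {sd : Bool} {a : ℕ} {c : Cluster} (h : c.Mark sd a) :
    ∃ P L S : Cluster, (comb a sd P L S).toTree.Sub c.toTree ∧
      ∀ i, c.Edge i P.port (bif i == sd then L.top else S.top) := by
  induction c with
  | single v => exact h.elim
  | comb a' sd' P L S ihP ihL ihS =>
    rcases h with ⟨rfl, rfl⟩ | h | h | h
    · exact ⟨P, L, S, .refl _, fun i => Or.inr (Or.inr (Or.inr ⟨rfl, rfl⟩))⟩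
    · obtain ⟨P', L', S', h1, h2⟩ := ihP h
      exact ⟨P', L', S', Or.inr (Or.inl (Or.inr (Or.inl h1))), fun i => Or.inl (h2 i)⟩
    · obtain ⟨P', L', S', h1, h2⟩ := ihL h
      exact ⟨P', L', S', Or.inr (Or.inl (Or.inr (Or.inr h1))), fun i => Or.inr (Or.inl (h2 i))⟩
    · obtain ⟨P', L', S', h1, h2⟩ := ihS h
      exact ⟨P', L', S', Or.inr (Or.inr h1), fun i => Or.inr (Or.inr (Or.inl (h2 i)))⟩

theorem Edge.exists_sub {i : Bool} {u v : ℕ} {c : Cluster} (h : c.Edge i u v) :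
    ∃ a sd, ∃ P L S : Cluster, c.Mark sd a ∧ (comb a sd P L S).toTree.Sub c.toTree ∧
      u = P.port ∧ v = bif i == sd then L.top else S.top := by
  induction c with
  | single v => exact h.elim
  | comb a' sd' P L S ihP ihL ihS =>
    rcases h with h | h | h | h
    · obtain ⟨a, sd, P', L', S', h1, h2, h3⟩ := ihP h
      exact ⟨a, sd, P', L', S', Or.inr (Or.inl h1), Or.inr (Or.inl (Or.inr (Or.inl h2))), h3⟩
    · obtain ⟨a, sd, P', L', S', h1, h2, h3⟩ := ihL h
      exact ⟨a, sd, P', L', S', Or.inr (Or.inr (Or.inl h1)),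
        Or.inr (Or.inl (Or.inr (Or.inr h2))), h3⟩
    · obtain ⟨a, sd, P', L', S', h1, h2, h3⟩ := ihS h
      exact ⟨a, sd, P', L', S', Or.inr (Or.inr (Or.inr h1)), Or.inr (Or.inr h2), h3⟩
    · exact ⟨a', sd', P, L, S, Or.inl ⟨rfl, rfl⟩, .refl _, h⟩

/-- The port of `P` is reached from the root of `P` by second children, and the top of `L` or `S`
from its root by first children. The target is `L`, below `a + 1`, if the mark of `a` equals `i`,
and `S`, directly below `a`, otherwise; these are the two alternatives in `EdgeRel`. -/
theorem edge_iff_edgeRel {c : Cluster} (hc : c.toTree.nodes.Nodup) (i : Bool) {u v : ℕ}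
    (hu : ∀ w, ¬ c.toTree.Child1 u w) (hv : ∀ w, ¬ c.toTree.Child1 v w) :
    c.Edge i u v ↔ MSO.EdgeRel c.toTree (fun a => c.Mark i a) (fun a => c.Mark (!i) a) u v := by
  have hu' : ∀ w, ¬ c.toTree.Child2 u w := by
    intro w hw
    obtain ⟨w', hw'⟩ := BinTree.exists_child1_iff.2 ⟨w, hw⟩
    exact hu w' hw'
  constructor
  · intro h
    obtain ⟨a, sd, P, L, S, hm, hs, rfl, rfl⟩ := h.exists_sub
    have hb := (BinTree.Sub.left _ _ _).trans hs
    refine ⟨a, a + 1, P.toTree.root, if i = sd then L.toTree.root else S.toTree.root,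
      (hs.child1 hc).2 rfl, (hb.child1 hc).2 rfl, ?_, ?_, ?_⟩
    · rw [← rightmost_toTree]
      exact ((BinTree.Sub.left _ _ _).trans hb).reach_rightmost
    · by_cases his : i = sd
      · simpa [his, leftmost_toTree] using ((BinTree.Sub.right _ _ _).trans hb).reach_leftmost
      · simpa [his, beq_false_of_ne his, leftmost_toTree] using ((BinTree.Sub.right _ _ _).trans hs).reach_leftmost
    · by_cases his : i = sd
      · subst his
        exact Or.inl ⟨hm, (hb.child2 hc).2 (by simp)⟩
      · obtain rfl : sd = !i := by revert his; cases i <;> cases sd <;> simp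
        exact Or.inr ⟨hm, (hs.child2 hc).2 (by simp)⟩
  · rintro ⟨a, b, q, w, h1, h2, h3, h4, h5⟩
    -- Once the side of the mark is fixed, both alternatives say that `w` is the second child of `b`
    -- or of `a`. Uniqueness of children then identifies `a`, `b`, `q`, `w` with the parts of the
    -- combination.
    have key (sd : Bool) (hm : c.Mark sd a)
        (hw : c.toTree.Child2 (bif i == sd then b else a) w) : c.Edge i u v := by
      obtain ⟨P, L, S, hs, he⟩ := hm.exists_sub
      have hb := (BinTree.Sub.left _ _ _).trans hs
      obtain rfl := (hs.child1 hc).1 h1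
      obtain rfl := (hb.child1 hc).1 h2
      obtain rfl := ((BinTree.Sub.left _ _ _).trans hb).eq_rightmost hc hu' h3
      specialize he i
      rw [rightmost_toTree]
      by_cases his : i = sd
      · subst his
        simp only [beq_self_eq_true, cond_true] at hw he
        obtain rfl := (hb.child2 hc).1 hw
        obtain rfl := ((BinTree.Sub.right _ _ _).trans hb).eq_leftmost hc hv h4
        rwa [leftmost_toTree]
      · rw [beq_false_of_ne his] at hw he
        simp only [cond_false] at hw he
        obtain rfl := (hs.child2 hc).1 hw
        obtain rfl := ((BinTree.Sub.right _ _ _).trans hs).eq_leftmost hc hv h4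
        rwa [leftmost_toTree]
    rcases h5 with ⟨h5, h6⟩ | ⟨h5, h6⟩
    · exact key i h5 (by simpa using h6)
    · exact key (!i) h5 (by simpa using h6)

end Cluster

/-! ### Contracting a tree of clusters -/

/-- Full binary trees in which each node carries an identifier and a cluster. -/
inductive ClusterTree : Type
  | leaf (v : ℕ) (c : Cluster) : ClusterTree
  | node (v : ℕ) (c : Cluster) (l r : ClusterTree) : ClusterTree

namespace ClusterTree

/-- The identifier of the root. -/
def root : ClusterTree → ℕ
  | leaf v _ => v
  | node v _ _ _ => v

/-- The cluster of the root. -/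
def cluster : ClusterTree → Cluster
  | leaf _ c => c
  | node _ c _ _ => c

/-- The identifiers of the nodes in preorder. -/
def nodes : ClusterTree → List ℕ
  | leaf v _ => [v]
  | node v _ l r => v :: (l.nodes ++ r.nodes)

/-- The number of leaves. -/
def leaves : ClusterTree → ℕ
  | leaf _ _ => 1
  | node _ _ l r => l.leaves + r.leaves

/-- The tree is a single leaf. -/
def IsLeaf : ClusterTree → Prop
  | leaf _ _ => True
  | node _ _ _ _ => False

/-- The multiset of the nodes of all clusters. -/
def ids : ClusterTree → Multiset ℕ
  | leaf _ c => c.ids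
  | node _ c l r => c.ids + l.ids + r.ids

/-- The child relations of the tree that is partitioned into the clusters. -/
def Edge (i : Bool) (u v : ℕ) : ClusterTree → Prop
  | leaf _ c => c.Edge i u v
  | node _ c l r => c.Edge i u v ∨ l.Edge i u v ∨ r.Edge i u v ∨
      u = c.port ∧ v = bif i then l.cluster.top else r.cluster.top

/-- All clusters satisfy `p`. -/
def All (p : Cluster → Prop) : ClusterTree → Prop
  | leaf _ c => p c
  | node _ c l r => p c ∧ l.All p ∧ r.All p

/-- Every node of the tree is a cluster of its own. -/
def ofTree : BinTree → ClusterTree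
  | .leaf v => leaf v (.single v)
  | .node v l r => node v (.single v) (ofTree l) (ofTree r)

/-- Let a node with identifier `v` and cluster `c` absorb one child, a leaf with cluster `cl`, and
then the other child, which is given as the last argument. -/
def absorb (a : ℕ) (sd : Bool) (v : ℕ) (c cl : Cluster) : ClusterTree → ClusterTree
  | leaf _ cs => leaf v (.comb a sd c cl cs)
  | node _ cs l r => node v (.comb a sd c cl cs) l r

/-- Absorb the children if possible; `bl` and `br` tell if the children have absorbed others. -/
def join (f v : ℕ) (c : Cluster) : Bool → Bool → ClusterTree → ClusterTree → ClusterTree × ℕ × Bool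
  | false, false, leaf _ cl, s => (absorb f true v c cl s, f + 2, true)
  | false, false, node w cs l r, leaf _ cl => (absorb f false v c cl (node w cs l r), f + 2, true)
  | _, _, l, r => (node v c l r, f, false)

/-- One round of the contraction.  The argument is the least unused identifier.  The result consists
of the tree, of the least unused identifier, and of a flag that tells if the root has absorbed its
children. -/
def round : ClusterTree → ℕ → ClusterTree × ℕ × Bool
  | leaf v c, f => (leaf v c, f, false)
  | node v c l r, f => join (l.round (r.round f).2.1).2.1 v c
      (l.round (r.round f).2.1).2.2 (r.round f).2.2 (l.round (r.round f).2.1).1 (r.round f).1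

/-! ### What one round changes and what it preserves -/

theorem join_cases (f v : ℕ) (c : Cluster) (bl br : Bool) (l r : ClusterTree) :
    (bl = false ∧ br = false ∧ ∃ w cl, l = leaf w cl ∧
      join f v c bl br l r = (absorb f true v c cl r, f + 2, true)) ∨
    (bl = false ∧ br = false ∧ ¬ l.IsLeaf ∧ ∃ w cl, r = leaf w cl ∧
      join f v c bl br l r = (absorb f false v c cl l, f + 2, true)) ∨
    ((bl = false → br = false → ¬ l.IsLeaf ∧ ¬ r.IsLeaf) ∧
      join f v c bl br l r = (node v c l r, f, false)) := by
  cases bl <;> cases br <;> cases l <;> cases r <;> simp [join, IsLeaf]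

theorem root_absorb (a : ℕ) (sd : Bool) (v : ℕ) (c cl : Cluster) (s : ClusterTree) :
    (absorb a sd v c cl s).root = v := by
  cases s <;> rfl

theorem cluster_absorb (a : ℕ) (sd : Bool) (v : ℕ) (c cl : Cluster) (s : ClusterTree) :
    (absorb a sd v c cl s).cluster = .comb a sd c cl s.cluster := by
  cases s <;> rfl

theorem leaves_absorb (a : ℕ) (sd : Bool) (v : ℕ) (c cl : Cluster) (s : ClusterTree) :
    (absorb a sd v c cl s).leaves = s.leaves := by
  cases s <;> rfl

theorem ids_absorb (a : ℕ) (sd : Bool) (v : ℕ) (c cl : Cluster) (s : ClusterTree) :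
    (absorb a sd v c cl s).ids = {a} + {a + 1} + c.ids + cl.ids + s.ids := by
  cases s <;> simp only [absorb, ids, Cluster.ids, add_assoc]

theorem leaves_pos (W : ClusterTree) : 0 < W.leaves := by
  induction W with
  | leaf v c => exact Nat.one_pos
  | node v c l r ihl ihr => simp only [leaves]; omega

theorem IsLeaf.leaves_eq {W : ClusterTree} (h : W.IsLeaf) : W.leaves = 1 := by
  cases W with
  | leaf v c => rfl
  | node v c l r => exact h.elim

theorem isLeaf_iff {W : ClusterTree} : W.IsLeaf ↔ W.leaves = 1 := by
  refine ⟨IsLeaf.leaves_eq, fun h => ?_⟩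
  cases W with
  | leaf v c => trivial
  | node v c l r =>
    have := l.leaves_pos
    have := r.leaves_pos
    simp only [leaves] at h
    omega

theorem length_nodes (W : ClusterTree) : W.nodes.length + 1 = 2 * W.leaves := by
  induction W with
  | leaf v c => rfl
  | node v c l r ihl ihr => simp only [nodes, leaves, List.length_cons, List.length_append]; omega

theorem IsLeaf.round_eq {W : ClusterTree} (h : W.IsLeaf) (f : ℕ) : W.round f = (W, f, false) := by
  cases W with
  | leaf v c => rfl
  | node v c l r => exact h.elim

theorem root_round (W : ClusterTree) (f : ℕ) : (W.round f).1.root = W.root := by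
  cases W with
  | leaf v c => rfl
  | node v c l r =>
    rw [round]
    rcases join_cases (l.round (r.round f).2.1).2.1 v c (l.round (r.round f).2.1).2.2
      (r.round f).2.2 (l.round (r.round f).2.1).1 (r.round f).1 with
      ⟨_, _, w, cl, _, h⟩ | ⟨_, _, _, w, cl, _, h⟩ | ⟨_, h⟩
    · rw [h, root_absorb]; rfl
    · rw [h, root_absorb]; rfl
    · rw [h]; rfl

theorem nodes_absorb_sublist (a : ℕ) (sd : Bool) (v : ℕ) (c cl : Cluster) (s : ClusterTree) :
    (absorb a sd v c cl s).nodes.Sublist (v :: s.nodes) := by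
  cases s with
  | leaf w cs => simp [absorb, nodes]
  | node w cs l r => simp [absorb, nodes]

theorem nodes_round_sublist (W : ClusterTree) (f : ℕ) : (W.round f).1.nodes.Sublist W.nodes := by
  induction W generalizing f with
  | leaf v c => exact .refl _
  | node v c l r ihl ihr =>
    rw [round]
    specialize ihr f
    specialize ihl (r.round f).2.1
    rcases join_cases (l.round (r.round f).2.1).2.1 v c (l.round (r.round f).2.1).2.2
      (r.round f).2.2 (l.round (r.round f).2.1).1 (r.round f).1 with
      ⟨_, _, w, cl, _, h⟩ | ⟨_, _, _, w, cl, _, h⟩ | ⟨_, h⟩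
    · rw [h]
      exact (nodes_absorb_sublist _ _ _ _ _ _).trans
        ((ihr.trans (List.sublist_append_right _ _)).cons_cons v)
    · rw [h]
      exact (nodes_absorb_sublist _ _ _ _ _ _).trans
        ((ihl.trans (List.sublist_append_left _ _)).cons_cons v)
    · rw [h]
      exact (ihl.append ihr).cons_cons v

/-- Each absorption removes one leaf and uses two fresh identifiers. This bounds all identifiers by
twice the size of the original tree. -/
theorem leaves_round (W : ClusterTree) (f : ℕ) :
    (W.round f).2.1 + 2 * (W.round f).1.leaves = f + 2 * W.leaves := by
  induction W generalizing f with
  | leaf v c => rfl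
  | node v c l r ihl ihr =>
    rw [round]
    specialize ihr f
    specialize ihl (r.round f).2.1
    rcases join_cases (l.round (r.round f).2.1).2.1 v c (l.round (r.round f).2.1).2.2
      (r.round f).2.2 (l.round (r.round f).2.1).1 (r.round f).1 with
      ⟨_, _, w, cl, hl, h⟩ | ⟨_, _, _, w, cl, hl, h⟩ | ⟨_, h⟩ <;> rw [h]
    · simp only [hl, leaves, leaves_absorb] at ihl ⊢; omega
    · simp only [hl, leaves, leaves_absorb] at ihr ⊢; omega
    · simp only [leaves]; omega

/-- The factor `3/4` alone is not inductive. An absorbing root leaves one unit of credit, which pays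
for a leaf sibling: if exactly one child is a leaf and the node does not absorb, then the other
child has just absorbed. The second claim ensures that an unflagged child that looks like a leaf
after its round was a leaf before. -/
theorem leaves_round_le (W : ClusterTree) (f : ℕ) (hW : ¬ W.IsLeaf) :
    4 * (W.round f).1.leaves + (if (W.round f).2.2 then 1 else 0) ≤ 3 * W.leaves ∧
      ((W.round f).2.2 = false → ¬ (W.round f).1.IsLeaf) := by
  induction W generalizing f with
  | leaf v c => exact (hW trivial).elim
  | node v c l r ihl ihr =>
    rw [round]
    specialize ihr f
    specialize ihl (r.round f).2.1
    have hr := fun h : r.IsLeaf => h.round_eq f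
    have hl := fun h : l.IsLeaf => h.round_eq (r.round f).2.1
    have hr1 := fun h : r.IsLeaf => h.leaves_eq
    have hl1 := fun h : l.IsLeaf => h.leaves_eq
    have hr0 := r.leaves_pos
    have hl0 := l.leaves_pos
    rcases join_cases (l.round (r.round f).2.1).2.1 v c (l.round (r.round f).2.1).2.2
      (r.round f).2.2 (l.round (r.round f).2.1).1 (r.round f).1 with
      ⟨h1, h2, w, cl, h3, h⟩ | ⟨h1, h2, h3, w, cl, h4, h⟩ | ⟨h1, h⟩ <;> rw [h]
    · have : l.IsLeaf := by
        by_contra hl'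
        exact (ihl hl').2 h1 (h3 ▸ trivial)
      refine ⟨?_, by simp⟩
      simp only [leaves_absorb, leaves, hl1 this, if_true]
      by_cases hr' : r.IsLeaf
      · rw [hr hr']; simp [hr1 hr']
      · have := (ihr hr').1
        simp only [h2] at this
        omega
    · have : r.IsLeaf := by
        by_contra hr'
        exact (ihr hr').2 h2 (h4 ▸ trivial)
      refine ⟨?_, by simp⟩
      have hl' : ¬ l.IsLeaf := fun hl' => h3 (by rw [hl hl']; exact hl')
      have hle := (ihl hl').1
      simp only [leaves_absorb, leaves, hr1 this, if_true]
      simp only [h1] at hle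
      omega
    · refine ⟨?_, fun _ => id⟩
      simp only [leaves]
      by_cases hr' : r.IsLeaf <;> by_cases hl' : l.IsLeaf
      · rw [hl hl', hr hr'] at h1
        exact absurd hl' (h1 rfl rfl).1
      · have hle := (ihl hl').1
        -- With `r` a leaf, the node could only be kept from absorbing by the flag of `l`, so the
        -- credit of `l` is available.
        have : (l.round (r.round f).2.1).2.2 = true := by
          by_contra hc
          rw [Bool.not_eq_true] at hc
          refine (h1 hc ?_).2 ?_ <;> rw [hr hr']
          exact hr'
        rw [if_pos this] at hle
        simp only [hr hr', hr1 hr'] at hle ⊢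
        simp
        omega
      · have hle := (ihr hr').1
        have : (r.round f).2.2 = true := by
          by_contra hc
          rw [Bool.not_eq_true] at hc
          refine (h1 ?_ hc).1 ?_ <;> rw [hl hl']
          exact hl'
        rw [if_pos this] at hle
        simp only [hl hl', hl1 hl']
        simp
        omega
      · have hle := (ihr hr').1
        have hle' := (ihl hl').1
        simp
        omega

/-- The identifiers gained are exactly those by which the counter has moved. Adding initial segments
to both sides avoids subtraction of multisets; in the end it shows that the nodes of `T'` are
numbered without gaps or repetitions. -/
theorem ids_round (W : ClusterTree) (f : ℕ) :
    (W.round f).1.ids + Multiset.range f = W.ids + Multiset.range (W.round f).2.1 := by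
  induction W generalizing f with
  | leaf v c => rfl
  | node v c l r ihl ihr =>
    rw [round]
    specialize ihr f
    specialize ihl (r.round f).2.1
    have hrange (n : ℕ) : Multiset.range (n + 2) = {n} + {n + 1} + Multiset.range n := by
      rw [Multiset.range_succ, Multiset.range_succ, ← Multiset.singleton_add,
        ← Multiset.singleton_add, ← add_assoc, add_comm {n + 1}]
    ext x
    replace ihl := congrArg (Multiset.count x) ihl
    replace ihr := congrArg (Multiset.count x) ihr
    rcases join_cases (l.round (r.round f).2.1).2.1 v c (l.round (r.round f).2.1).2.2
      (r.round f).2.2 (l.round (r.round f).2.1).1 (r.round f).1 with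
      ⟨_, _, w, cl, hl, h⟩ | ⟨_, _, _, w, cl, hl, h⟩ | ⟨_, h⟩ <;> rw [h]
    · simp only [hl, ids, ids_absorb, Multiset.count_add, hrange] at ihl ihr ⊢
      omega
    · simp only [hl, ids, ids_absorb, Multiset.count_add, hrange] at ihl ihr ⊢
      omega
    · simp only [ids, Multiset.count_add] at ihl ihr ⊢
      omega

/-- Absorption only extends a cluster downwards. Hence the edge that enters the root cluster from
above is not affected. -/
theorem top_round (W : ClusterTree) (f : ℕ) : (W.round f).1.cluster.top = W.cluster.top := by
  cases W with
  | leaf v c => rfl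
  | node v c l r =>
    rw [round]
    rcases join_cases (l.round (r.round f).2.1).2.1 v c (l.round (r.round f).2.1).2.2
      (r.round f).2.2 (l.round (r.round f).2.1).1 (r.round f).1 with
      ⟨_, _, w, cl, _, h⟩ | ⟨_, _, _, w, cl, _, h⟩ | ⟨_, h⟩
    · rw [h, cluster_absorb]; rfl
    · rw [h, cluster_absorb]; rfl
    · rw [h]; rfl

theorem edge_absorb {i : Bool} {u v : ℕ} (a : ℕ) (sd : Bool) (w : ℕ) (c cl : Cluster)
    (s : ClusterTree) : (absorb a sd w c cl s).Edge i u v ↔ c.Edge i u v ∨ cl.Edge i u v ∨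
      s.Edge i u v ∨ u = c.port ∧ v = bif i == sd then cl.top else s.cluster.top := by
  cases s with
  | leaf _ cs => rfl
  | node _ cs l r => simp only [absorb, Edge, Cluster.Edge, Cluster.port, cluster]; tauto

/-- The two edges from the absorbing cluster to its children become edges inside the combination.
Edges below the other child stay, since the combination inherits its port. -/
theorem edge_round {i : Bool} {u v : ℕ} (W : ClusterTree) (f : ℕ) :
    (W.round f).1.Edge i u v ↔ W.Edge i u v := by
  induction W generalizing f with
  | leaf v c => rfl
  | node v c l r ihl ihr =>
    rw [round]
    specialize ihr f
    specialize ihl (r.round f).2.1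
    have tr := r.top_round f
    have tl := l.top_round (r.round f).2.1
    rcases join_cases (l.round (r.round f).2.1).2.1 v c (l.round (r.round f).2.1).2.2
      (r.round f).2.2 (l.round (r.round f).2.1).1 (r.round f).1 with
      ⟨_, _, w, cl, hl, h⟩ | ⟨_, _, _, w, cl, hl, h⟩ | ⟨_, h⟩ <;> rw [h]
    · rw [hl] at tl ihl
      rw [edge_absorb, ihr, tr, Edge, ← ihl, ← tl]
      cases i <;> rfl
    · rw [hl] at tr ihr
      rw [edge_absorb, ihl, tl, Edge, ← ihr, ← tr]
      have hi : (bif i == false then cl.top else l.cluster.top) =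
          bif i then l.cluster.top else cl.top := by cases i <;> rfl
      rw [hi]
      exact or_congr_right ⟨fun h => by tauto, fun h => by tauto⟩
    · simp only [Edge, ihr, ihl, tl, tr]

theorem All.mono {p q : Cluster → Prop} (hpq : ∀ c, p c → q c) {W : ClusterTree} (h : W.All p) :
    W.All q := by
  induction W with
  | leaf v c => exact hpq _ h
  | node v c l r ihl ihr => exact ⟨hpq _ h.1, ihl h.2.1, ihr h.2.2⟩

theorem All.cluster {p : Cluster → Prop} {W : ClusterTree} (h : W.All p) : p W.cluster := by
  cases W with
  | leaf v c => exact h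
  | node v c l r => exact h.1

theorem All.absorb {p : Cluster → Prop} {a : ℕ} {sd : Bool} {v : ℕ} {c cl : Cluster}
    {s : ClusterTree} (h : s.All p) (hc : p (.comb a sd c cl s.cluster)) :
    (ClusterTree.absorb a sd v c cl s).All p := by
  cases s with
  | leaf _ cs => exact hc
  | node _ cs l r => exact ⟨hc, h.2⟩

/-- The flags serve this bound: an unflagged root still has its old cluster, so a combination adds
its two levels to clusters of height at most `H`, never to clusters that have grown in the same
round. -/
theorem height_round {W : ClusterTree} {H : ℕ} (hW : W.All fun c => c.toTree.height ≤ H) (f : ℕ) :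
    ((W.round f).1.All fun c => c.toTree.height ≤ H + 2) ∧
      ((W.round f).2.2 = false → (W.round f).1.cluster.toTree.height ≤ H) := by
  induction W generalizing f with
  | leaf v c => exact ⟨hW.mono fun c h => h.trans (by omega), fun _ => hW.cluster⟩
  | node v c l r ihl ihr =>
    rw [round]
    obtain ⟨hc, hl, hr⟩ := hW
    specialize ihr hr f
    specialize ihl hl (r.round f).2.1
    rcases join_cases (l.round (r.round f).2.1).2.1 v c (l.round (r.round f).2.1).2.2
      (r.round f).2.2 (l.round (r.round f).2.1).1 (r.round f).1 with
      ⟨h1, h2, w, cl, hl, h⟩ | ⟨h1, h2, _, w, cl, hl, h⟩ | ⟨_, h⟩ <;> rw [h]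
    · refine ⟨ihr.1.absorb ?_, by simp⟩
      have := ihr.2 h2
      have := ihl.2 h1
      simp only [hl, ClusterTree.cluster] at this
      simp only [Cluster.toTree, BinTree.height]
      omega
    · refine ⟨ihl.1.absorb ?_, by simp⟩
      have := ihl.2 h1
      have := ihr.2 h2
      simp only [hl, ClusterTree.cluster] at this
      simp only [Cluster.toTree, BinTree.height]
      omega
    · exact ⟨⟨by omega, ihl.1, ihr.1⟩, fun _ => hc⟩

theorem le_round (W : ClusterTree) (f : ℕ) : f ≤ (W.round f).2.1 := by
  induction W generalizing f with
  | leaf v c => exact le_rfl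
  | node v c l r ihl ihr =>
    rw [round]
    specialize ihr f
    specialize ihl (r.round f).2.1
    rcases join_cases (l.round (r.round f).2.1).2.1 v c (l.round (r.round f).2.1).2.2
      (r.round f).2.2 (l.round (r.round f).2.1).1 (r.round f).1 with
      ⟨h1, h2, w, cl, hl, h⟩ | ⟨h1, h2, _, w, cl, hl, h⟩ | ⟨_, h⟩ <;> rw [h] <;>
      simp only <;> omega

theorem inRange_round {W : ClusterTree} {n f : ℕ} (hW : W.All (Cluster.InRange n f)) (hf : n ≤ f) :
    (W.round f).1.All (Cluster.InRange n (W.round f).2.1) := by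
  induction W generalizing f with
  | leaf v c => exact hW
  | node v c l r ihl ihr =>
    rw [round]
    obtain ⟨hc, hl, hr⟩ := hW
    have h1 := r.le_round f
    have h2 := l.le_round (r.round f).2.1
    specialize ihr hr hf
    specialize ihl (hl.mono fun c hc => hc.mono h1) (hf.trans h1)
    have hm {f' : ℕ} (hf' : (l.round (r.round f).2.1).2.1 ≤ f') :=
      ihr.mono fun c hc => hc.mono (h2.trans hf')
    have hm' {f' : ℕ} (hf' : (l.round (r.round f).2.1).2.1 ≤ f') :=
      ihl.mono fun c hc => hc.mono hf'
    rcases join_cases (l.round (r.round f).2.1).2.1 v c (l.round (r.round f).2.1).2.2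
      (r.round f).2.2 (l.round (r.round f).2.1).1 (r.round f).1 with
      ⟨_, _, w, cl, hl, h⟩ | ⟨_, _, _, w, cl, hl, h⟩ | ⟨_, h⟩ <;> rw [h]
    · have hx := hm' (Nat.le_add_right _ 2)
      rw [hl] at hx
      have hy := hm (Nat.le_add_right _ 2)
      exact hy.absorb ⟨by omega, by simp, hc.mono (by omega), hx, hy.cluster⟩
    · have hx := hm (Nat.le_add_right _ 2)
      rw [hl] at hx
      have hy := hm' (Nat.le_add_right _ 2)
      exact hy.absorb ⟨by omega, by simp, hc.mono (by omega), hx, hy.cluster⟩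
    · exact ⟨hc.mono (by simp only; omega), hm' le_rfl, hm le_rfl⟩

end ClusterTree

/-! ### Programs without loops, and iterations of loop bodies -/

namespace RamState

theorem reg_setReg (s : RamState) (x c y : ℕ) :
    (s.setReg x c).reg y = if y = x then c else s.reg y := by
  simp [setReg, Function.update_apply]

theorem arr_setReg (s : RamState) (x c : ℕ) : (s.setReg x c).arr = s.arr := rfl

theorem reg_setArr (s : RamState) (a i c : ℕ) : (s.setArr a i c).reg = s.reg := rfl

theorem arr_setArr (s : RamState) (a i c b : ℕ) :
    (s.setArr a i c).arr b = if b = a then Function.update (s.arr a) i c else s.arr b := by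
  simp [setArr, Function.update_apply]

end RamState

namespace RamProg

/-- The configuration in which a program without loops halts. -/
def run : RamProg → RamState → RamState
  | skip, s => s
  | const x c, s => s.setReg x c
  | add x y z, s => s.setReg x (s.reg y + s.reg z)
  | sub x y z, s => s.setReg x (s.reg y - s.reg z)
  | load x a y, s => s.setReg x (s.arr a (s.reg y))
  | store a x y, s => s.setArr a (s.reg x) (s.reg y)
  | seq P P', s => P'.run (P.run s)
  | cond x P P', s => if s.reg x ≠ 0 then P.run s else P'.run s
  | loop _ _, s => s

/-- The program has no loops and respects the word bound `W`. -/
def Safe (W : ℕ) : RamProg → RamState → Prop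
  | skip, _ => True
  | const _ c, _ => c ≤ W
  | add _ y z, s => s.reg y + s.reg z ≤ W
  | sub _ _ _, _ => True
  | load _ _ _, _ => True
  | store _ _ _, _ => True
  | seq P P', s => P.Safe W s ∧ P'.Safe W (P.run s)
  | cond x P P', s => if s.reg x ≠ 0 then P.Safe W s else P'.Safe W s
  | loop _ _, _ => False

/-- A bound for the time that a program without loops takes. -/
def len : RamProg → ℕ
  | seq P P' => P.len + P'.len
  | cond _ P P' => max P.len P'.len + 1
  | _ => 1

/-- Run programs one after the other. -/
def block : List RamProg → RamProg
  | [] => skip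
  | P :: L => seq P (block L)

/-- Loop bodies are loop-free, so they can be verified by evaluating the function `run` instead of
building derivations of `RamExec`. -/
theorem Safe.exec {W : ℕ} {P : RamProg} {s : RamState} (h : P.Safe W s) :
    ∃ t ≤ P.len, RamExec W P s t (P.run s) := by
  induction P generalizing s with
  | skip => exact ⟨1, le_rfl, .skip s⟩
  | const x c => exact ⟨1, le_rfl, .const s x c h⟩
  | add x y z => exact ⟨1, le_rfl, .add s x y z h⟩
  | sub x y z => exact ⟨1, le_rfl, .sub s x y z⟩
  | load x a y => exact ⟨1, le_rfl, .load s x a y⟩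
  | store a x y => exact ⟨1, le_rfl, .store s a x y⟩
  | seq P P' ih ih' =>
    obtain ⟨t, ht, h1⟩ := ih h.1
    obtain ⟨t', ht', h2⟩ := ih' h.2
    exact ⟨t + t', Nat.add_le_add ht ht', .seq h1 h2⟩
  | cond x P P' ih ih' =>
    simp only [Safe] at h
    by_cases hx : s.reg x = 0
    · rw [if_neg (not_not.2 hx)] at h
      obtain ⟨t, ht, h1⟩ := ih' h
      refine ⟨t + 1, by simp only [len]; omega, ?_⟩
      rw [run, if_neg (not_not.2 hx)]
      exact .cond_false hx h1
    · rw [if_pos hx] at h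
      obtain ⟨t, ht, h1⟩ := ih h
      refine ⟨t + 1, by simp only [len]; omega, ?_⟩
      rw [run, if_pos hx]
      exact .cond_true hx h1
  | loop x P => exact h.elim

end RamProg

/-- Some iterations of the body `P` of a loop that tests the register `x`. -/
inductive RamIter (W x : ℕ) (P : RamProg) : RamState → ℕ → RamState → Prop
  | refl (s : RamState) : RamIter W x P s 0 s
  | step {s s₁ s₂ : RamState} {t t' : ℕ} (hx : s.reg x ≠ 0) (h : RamExec W P s t s₁)
      (h' : RamIter W x P s₁ t' s₂) : RamIter W x P s (t + t' + 1) s₂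

namespace RamIter

variable {W x : ℕ} {P : RamProg} {s s₁ s₂ : RamState} {t t' : ℕ}

/-- One loop traverses the whole tree, so its iterations for the subtrees must be composed without
leaving the loop; `RamIter.exec` adds the final test. -/
theorem trans (h : RamIter W x P s t s₁) (h' : RamIter W x P s₁ t' s₂) :
    RamIter W x P s (t + t') s₂ := by
  induction h with
  | refl s => simpa using h'
  | @step s s₁ s₃ t t'' hx he _ ih =>
    have := RamIter.step hx he (ih h')
    rwa [show t + (t'' + t') + 1 = t + t'' + 1 + t' by omega] at this

theorem single (hx : s.reg x ≠ 0) (h : RamExec W P s t s₁) : RamIter W x P s (t + 1) s₁ :=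
  .step hx h (.refl _)

theorem exec (h : RamIter W x P s t s₁) (hx : s₁.reg x = 0) :
    RamExec W (.loop x P) s (t + 1) s₁ := by
  induction h with
  | refl s => exact .loop_false hx
  | @step s s₁ s₃ t t'' hx' he _ ih =>
    have := RamExec.loop_true hx' he (ih hx)
    rwa [show t + (t'' + 1) + 1 = t + t'' + 1 + 1 by omega] at this

end RamIter

/-! ### The list of the nodes of a tree -/

/-- The array `a` contains the list at the position `j`. -/
def ArrList (a : ℕ → ℕ) : ℕ → List ℕ → Prop
  | _, [] => True
  | j, x :: L => a j = x ∧ ArrList a (j + 1) L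

theorem arrList_append {a : ℕ → ℕ} {j : ℕ} {L L' : List ℕ} :
    ArrList a j (L ++ L') ↔ ArrList a j L ∧ ArrList a (j + L.length) L' := by
  induction L generalizing j with
  | nil => simp [ArrList]
  | cons x L ih =>
    simp only [List.cons_append, ArrList, ih, List.length_cons, and_assoc]
    rw [show j + 1 + L.length = j + (L.length + 1) by omega]

theorem ArrList.congr {a b : ℕ → ℕ} {j : ℕ} {L : List ℕ} (h : ArrList a j L)
    (hab : ∀ i, j ≤ i → i < j + L.length → b i = a i) : ArrList b j L := by
  induction L generalizing j with
  | nil => trivial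
  | cons x L ih =>
    simp only [List.length_cons] at hab
    exact ⟨(hab j le_rfl (by omega)).trans h.1,
      ih h.2 fun i hi hi' => hab i (by omega) (by omega)⟩

namespace ClusterTree

/-- The child pointers are in the arrays `0` and `1`, and the sum of the number `v` and of the entry
`v` of the array `k + 4` identifies the root of the cluster of the node `v`. -/
def Pointers (k : ℕ) (s : RamState) : ClusterTree → Prop
  | leaf v c => s.arr 0 v = 0 ∧ v + s.arr (k + 4) v = c.toTree.root
  | node v c l r => s.arr 0 v = l.root + 1 ∧ s.arr 1 v = r.root + 1 ∧
      v + s.arr (k + 4) v = c.toTree.root ∧ l.Pointers k s ∧ r.Pointers k s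

theorem Pointers.congr {k : ℕ} {s s' : RamState} {W : ClusterTree} (h : W.Pointers k s)
    (hs : ∀ v ∈ W.nodes, s'.arr 0 v = s.arr 0 v ∧ s'.arr 1 v = s.arr 1 v ∧
      s'.arr (k + 4) v = s.arr (k + 4) v) : W.Pointers k s' := by
  induction W with
  | leaf v c =>
    obtain ⟨h0, h1, h4⟩ := hs v (List.mem_singleton_self v)
    exact ⟨h0.trans h.1, h4.symm ▸ h.2⟩
  | node v c l r ihl ihr =>
    obtain ⟨h0, h1, h4⟩ := hs v List.mem_cons_self
    exact ⟨h0.trans h.1, h1.trans h.2.1, h4.symm ▸ h.2.2.1,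
      ihl h.2.2.2.1 fun w hw => hs w (by simp [nodes, hw]),
      ihr h.2.2.2.2 fun w hw => hs w (by simp [nodes, hw])⟩

theorem length_nodes_pos (W : ClusterTree) : 0 < W.nodes.length := by
  cases W <;> simp [nodes]

theorem root_mem_nodes (W : ClusterTree) : W.root ∈ W.nodes := by
  cases W <;> simp [nodes, root]

end ClusterTree

/-- Move a node from the stack (array `k + 7`) to the list of nodes (array `k + 6`), reset its flag
(array `k + 5`), and put its children onto the stack. -/
def listBody (k : ℕ) : RamProg :=
  .block [.sub 4 4 7, .load 8 (k + 7) 4, .store (k + 6) 3 8, .add 3 3 7, .store (k + 5) 8 5,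
    .load 9 0 8, .cond 9 (.block [.load 10 1 8, .sub 10 10 7, .store (k + 7) 4 10, .add 4 4 7,
      .sub 9 9 7, .store (k + 7) 4 9, .add 4 4 7]) .skip]

theorem listBody_leaf {k B v H J : ℕ} {s : RamState} (hH : s.reg 4 = H + 1)
    (hv : s.arr (k + 7) H = v) (hJ : s.reg 3 = J) (h5 : s.reg 5 = 0) (h7 : s.reg 7 = 1)
    (h0 : s.arr 0 v = 0) (hJB : J + 1 ≤ B) :
    ∃ t s', t ≤ 20 ∧ RamIter B 4 (listBody k) s t s' ∧ s'.reg 4 = H ∧ s'.reg 3 = J + 1 ∧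
      (∀ x, x ≠ 3 → x ≠ 4 → x < 8 → s'.reg x = s.reg x) ∧
      (∀ a, a ≠ k + 5 → a ≠ k + 6 → s'.arr a = s.arr a) ∧
      s'.arr (k + 5) = Function.update (s.arr (k + 5)) v 0 ∧
      s'.arr (k + 6) = Function.update (s.arr (k + 6)) J v := by
  have hs : (listBody k).Safe B s := by
    simp [listBody, RamProg.Safe, RamProg.block, RamProg.run, RamState.reg_setReg,
      RamState.arr_setReg, RamState.reg_setArr, RamState.arr_setArr, *]
  obtain ⟨t, ht, he⟩ := hs.exec
  refine ⟨t + 1, _, ?_, .single (by omega) he, ?_⟩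
  · simp only [listBody, RamProg.len, RamProg.block] at ht; omega
  simp [listBody, RamProg.block, RamProg.run, RamState.reg_setReg,
      RamState.arr_setReg, RamState.reg_setArr, RamState.arr_setArr, *]
  constructor
  · intro x h3 h4 h8
    simp [h3, h4, show x ≠ 9 by omega, show x ≠ 8 by omega]
  · intro a h5 h6
    simp [h5, h6]

theorem listBody_node {k B v w w' H J : ℕ} {s : RamState} (hH : s.reg 4 = H + 1)
    (hv : s.arr (k + 7) H = v) (hJ : s.reg 3 = J) (h5 : s.reg 5 = 0) (h7 : s.reg 7 = 1)
    (h0 : s.arr 0 v = w + 1) (h1 : s.arr 1 v = w' + 1) (hJB : J + 1 ≤ B) (hHB : H + 2 ≤ B) :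
    ∃ t s', t ≤ 20 ∧ RamIter B 4 (listBody k) s t s' ∧ s'.reg 4 = H + 2 ∧ s'.reg 3 = J + 1 ∧
      (∀ x, x ≠ 3 → x ≠ 4 → x < 8 → s'.reg x = s.reg x) ∧
      (∀ a, a < k + 5 → s'.arr a = s.arr a) ∧
      s'.arr (k + 5) = Function.update (s.arr (k + 5)) v 0 ∧
      s'.arr (k + 6) = Function.update (s.arr (k + 6)) J v ∧
      s'.arr (k + 7) = Function.update (Function.update (s.arr (k + 7)) H w') (H + 1) w := by
  have hHB' : H + 1 ≤ B := by omega
  have hs : (listBody k).Safe B s := by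
    simp [listBody, RamProg.Safe, RamProg.block, RamProg.run, RamState.reg_setReg,
      RamState.arr_setReg, RamState.reg_setArr, RamState.arr_setArr, *]
  obtain ⟨t, ht, he⟩ := hs.exec
  refine ⟨t + 1, _, ?_, .single (by omega) he, ?_⟩
  · simp only [listBody, RamProg.len, RamProg.block] at ht; omega
  simp [listBody, RamProg.block, RamProg.run, RamState.reg_setReg,
      RamState.arr_setReg, RamState.reg_setArr, RamState.arr_setArr, *]
  constructor
  · intro x h3 h4 h8
    simp [h3, h4, show x ≠ 9 by omega, show x ≠ 8 by omega, show x ≠ 10 by omega]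
  · intro a ha
    simp [show a ≠ k + 5 by omega, show a ≠ k + 6 by omega, show a ≠ k + 7 by omega]

/-- With `W` on top of the stack, the loop eventually pops all of `W` and appends its preorder to
the list, leaving the stack below and the list before unchanged. The second child is pushed before
the first, so the first subtree is listed first. All flags of the round are reset on the way. -/
theorem listBody_iter {k B : ℕ} (W : ClusterTree) {s : RamState} {H J : ℕ} (hW : W.Pointers k s)
    (hH : s.reg 4 = H + 1) (hr : s.arr (k + 7) H = W.root) (hJ : s.reg 3 = J)
    (h5 : s.reg 5 = 0) (h7 : s.reg 7 = 1) (hHB : H + W.nodes.length ≤ B)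
    (hJB : J + W.nodes.length ≤ B) :
    ∃ t s', t ≤ 20 * W.nodes.length ∧ RamIter B 4 (listBody k) s t s' ∧
      s'.reg 4 = H ∧ s'.reg 3 = J + W.nodes.length ∧
      (∀ x, x ≠ 3 → x ≠ 4 → x < 8 → s'.reg x = s.reg x) ∧
      (∀ a, a < k + 5 → s'.arr a = s.arr a) ∧
      (∀ x, x ∈ W.nodes ∨ s.arr (k + 5) x = 0 → s'.arr (k + 5) x = 0) ∧
      ArrList (s'.arr (k + 6)) J W.nodes ∧ (∀ j < J, s'.arr (k + 6) j = s.arr (k + 6) j) ∧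
      ∀ j < H, s'.arr (k + 7) j = s.arr (k + 7) j := by
  induction W generalizing s H J with
  | leaf v c =>
    simp only [ClusterTree.nodes, List.length_singleton, ClusterTree.root] at *
    obtain ⟨t, s', ht, he, r4, r3, hreg, harr, a5, a6⟩ := listBody_leaf hH hr hJ h5 h7 hW.1 hJB
    refine ⟨t, s', by omega, he, r4, r3, hreg, fun a ha => harr a (by omega) (by omega), ?_, ?_, ?_,
      ?_⟩
    · intro x hx
      rw [a5, Function.update_apply]
      split_ifs with h
      · rfl
      · exact hx.resolve_left (by simpa using h)
    · simp [ArrList, a6]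
    · intro j hj
      rw [a6, Function.update_of_ne (by omega)]
    · intro j hj
      rw [harr _ (by omega) (by omega)]
  | node v c l r ihl ihr =>
    obtain ⟨h0, h1, _, hl, hr'⟩ := hW
    simp only [ClusterTree.nodes, List.length_cons, List.length_append, ClusterTree.root] at *
    have pl := l.length_nodes_pos
    have pr := r.length_nodes_pos
    obtain ⟨t, s₁, ht, he, r4, r3, hreg, harr, a5, a6, a7⟩ :=
      listBody_node (B := B) hH hr hJ h5 h7 h0 h1 (by omega) (by omega)
    obtain ⟨t', s₂, ht', he', r4', r3', hreg', harr', a5', a6', b6', a7'⟩ :=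
      ihl (s := s₁) (H := H + 1) (J := J + 1)
        (hl.congr fun v _ => by simp only [harr 0 (by omega), harr 1 (by omega),
          harr (k + 4) (by omega), and_self]) r4 (by simp [a7]) r3
        (by rw [hreg _ (by omega) (by omega) (by omega), h5])
        (by rw [hreg _ (by omega) (by omega) (by omega), h7]) (by omega) (by omega)
    obtain ⟨t'', s₃, ht'', he'', r4'', r3'', hreg'', harr'', a5'', a6'', b6'', a7''⟩ :=
      ihr (s := s₂) (H := H) (J := J + 1 + l.nodes.length)
        (hr'.congr fun v _ => by simp only [harr 0 (by omega), harr 1 (by omega),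
          harr (k + 4) (by omega), harr' 0 (by omega), harr' 1 (by omega),
          harr' (k + 4) (by omega), and_self]) r4'
        -- The second child was stored at `H`, below the first one at `H + 1`, and has survived the
        -- traversal of the first subtree.
        (by rw [a7' H (by omega), a7]; simp) r3'
        (by rw [hreg' _ (by omega) (by omega) (by omega), hreg _ (by omega) (by omega) (by omega), h5])
        (by rw [hreg' _ (by omega) (by omega) (by omega), hreg _ (by omega) (by omega) (by omega), h7])
        (by omega) (by omega)
    refine ⟨t + (t' + t''), s₃, by omega, he.trans (he'.trans he''), r4'', by omega, ?_, ?_, ?_, ?_, ?_, ?_⟩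
    · intro x x3 x4 x8
      rw [hreg'' x x3 x4 x8, hreg' x x3 x4 x8, hreg x x3 x4 x8]
    · intro a ha
      rw [harr'' a ha, harr' a ha, harr a ha]
    · intro x hx
      rw [List.mem_cons, List.mem_append] at hx
      by_cases hxr : x ∈ r.nodes
      · exact a5'' x (Or.inl hxr)
      refine a5'' x (Or.inr ?_)
      by_cases hxl : x ∈ l.nodes
      · exact a5' x (Or.inl hxl)
      refine a5' x (Or.inr ?_)
      rw [a5, Function.update_apply]
      split_ifs with h
      · rfl
      · tauto
    · refine ⟨?_, arrList_append.2 ⟨a6'.congr fun i hi hi' => b6'' i (by omega), a6''⟩⟩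
      rw [b6'' _ (by omega), b6' _ (by omega), a6, Function.update_self]
    · intro j hj
      rw [b6'' _ (by omega), b6' _ (by omega), a6, Function.update_of_ne (by omega)]
    · intro j hj
      rw [a7'' _ (by omega), a7' _ (by omega), a7, Function.update_of_ne (by omega),
        Function.update_of_ne (by omega)]

/-! ### The program for one round -/

/-- The node in register `8` absorbs the leaf in register `L` and the node in register `S`. -/
def absorbProg (k L S lab : ℕ) : RamProg :=
  .block [.store lab 2 7, .add 13 2 7, .load 14 (k + 4) 8, .add 14 14 8, .add 14 14 7,
    .store 0 13 14, .load 14 (k + 4) L, .add 14 14 L, .add 14 14 7, .store 1 13 14,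
    .load 14 (k + 4) S, .add 14 14 S, .add 14 14 7, .store 1 2 14, .add 14 13 7, .store 0 2 14,
    .load 14 0 S, .store 0 8 14, .load 14 1 S, .store 1 8 14, .sub 14 2 8, .store (k + 4) 8 14,
    .store (k + 5) 8 7, .add 2 13 7]

/-- Process the last node of the list of nodes. -/
def roundBody (k : ℕ) : RamProg :=
  .block [.sub 3 3 7, .load 8 (k + 6) 3, .load 9 0 8, .cond 9 (.block [.load 10 1 8, .sub 9 9 7,
    .sub 10 10 7, .load 11 (k + 5) 9, .load 12 (k + 5) 10, .add 11 11 12, .cond 11 .skip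
      (.block [.load 11 0 9, .cond 11 (.block [.load 12 0 10, .cond 12 .skip
        (absorbProg k 10 9 (k + 3))]) (absorbProg k 9 10 (k + 2))])]) .skip]

/-- In the configuration `s'`, the node `p` has absorbed the leaf `l` and the node `q`. -/
structure AbsorbStep (k f : ℕ) (sd : Bool) (p l q : ℕ) (s s' : RamState) : Prop where
  arr_zero : s'.arr 0 = Function.update (Function.update (Function.update (s.arr 0) (f + 1)
    (p + s.arr (k + 4) p + 1)) f (f + 2)) p (s.arr 0 q)
  arr_one : s'.arr 1 = Function.update (Function.update (Function.update (s.arr 1) (f + 1)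
    (l + s.arr (k + 4) l + 1)) f (q + s.arr (k + 4) q + 1)) p (s.arr 1 q)
  arr_label : s'.arr (bif sd then k + 2 else k + 3) =
    Function.update (s.arr (bif sd then k + 2 else k + 3)) f 1
  arr_root : s'.arr (k + 4) = Function.update (s.arr (k + 4)) p (f - p)
  arr_flag : s'.arr (k + 5) = Function.update (s.arr (k + 5)) p 1
  arr_other : ∀ a, a ≠ 0 → a ≠ 1 → a ≠ (bif sd then k + 2 else k + 3) → a ≠ k + 4 → a ≠ k + 5 →
    s'.arr a = s.arr a

theorem roundBody_absorb {k B f I p l r : ℕ} {sd : Bool} {s : RamState} (hI : s.reg 3 = I + 1)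
    (hp : s.arr (k + 6) I = p) (h2 : s.reg 2 = f) (h7 : s.reg 7 = 1) (h0 : s.arr 0 p = l + 1)
    (h1 : s.arr 1 p = r + 1) (hl : s.arr (k + 5) l = 0) (hr : s.arr (k + 5) r = 0)
    (hsd : bif sd then s.arr 0 l = 0 else s.arr 0 l ≠ 0 ∧ s.arr 0 r = 0)
    (hlf : l < f) (hrf : r < f)
    (hB : f + 2 ≤ B) (hpB : p + s.arr (k + 4) p < f) (hlB : l + s.arr (k + 4) l < f)
    (hrB : r + s.arr (k + 4) r < f) :
    ∃ t s', t ≤ 50 ∧ RamIter B 3 (roundBody k) s t s' ∧ s'.reg 3 = I ∧ s'.reg 2 = f + 2 ∧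
      (∀ x, x ≠ 2 → x ≠ 3 → x < 8 → s'.reg x = s.reg x) ∧
      AbsorbStep k f sd p (bif sd then l else r) (bif sd then r else l) s s' := by
  have e1 : f + 1 ≤ B := by omega
  have e2 : s.arr (k + 4) p + p ≤ B := by omega
  have e3 : s.arr (k + 4) p + p + 1 ≤ B := by omega
  have e4 : s.arr (k + 4) l + l ≤ B := by omega
  have e5 : s.arr (k + 4) l + l + 1 ≤ B := by omega
  have e6 : s.arr (k + 4) r + r ≤ B := by omega
  have e7 : s.arr (k + 4) r + r + 1 ≤ B := by omega
  have e8 : f + 1 + 1 ≤ B := by omega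
  -- The pointers of the non-leaf position `S` of the program are read after the cells `f` and `f +
  -- 1` have been written, so these must be different from the children.
  have e9 : l ≠ f := by omega
  have e10 : l ≠ f + 1 := by omega
  have e11 : r ≠ f := by omega
  have e12 : r ≠ f + 1 := by omega
  have hs : (roundBody k).Safe B s := by
    cases sd
    all_goals
      simp only [cond_true, cond_false] at hsd
      simp [roundBody, absorbProg, RamProg.Safe, RamProg.block, RamProg.run, RamState.reg_setReg,
        RamState.arr_setReg, RamState.reg_setArr, RamState.arr_setArr, *]
  obtain ⟨t, ht, he⟩ := hs.exec
  refine ⟨t + 1, _, ?_, .single (by omega) he, ?_, ?_, ?_, ?_⟩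
  · simp only [roundBody, absorbProg, RamProg.len, RamProg.block] at ht; omega
  · cases sd
    all_goals
      simp only [cond_true, cond_false] at hsd
      simp [roundBody, absorbProg, RamProg.block, RamProg.run, RamState.reg_setReg,
        RamState.arr_setReg, RamState.reg_setArr, RamState.arr_setArr, *]
  · cases sd
    all_goals
      simp only [cond_true, cond_false] at hsd
      simp [roundBody, absorbProg, RamProg.block, RamProg.run, RamState.reg_setReg,
        RamState.arr_setReg, RamState.reg_setArr, RamState.arr_setArr, *]
  · intro x x2 x3 x8
    have : x ≠ 8 ∧ x ≠ 9 ∧ x ≠ 10 ∧ x ≠ 11 ∧ x ≠ 12 ∧ x ≠ 13 ∧ x ≠ 14 := by omega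
    cases sd
    all_goals
      simp only [cond_true, cond_false] at hsd
      simp [roundBody, absorbProg, RamProg.block, RamProg.run, RamState.reg_setReg,
        RamState.arr_setReg, RamState.reg_setArr, RamState.arr_setArr, *]
  · cases sd
    all_goals
      simp only [cond_true, cond_false] at hsd
      constructor
      all_goals
        simp +contextual [roundBody, absorbProg, RamProg.block, RamProg.run, RamState.reg_setReg,
          RamState.arr_setReg, RamState.reg_setArr, RamState.arr_setArr, add_comm, *]
    all_goals rw [show 1 + (f + 1) = f + 2 by omega]

theorem roundBody_skip {k B I p : ℕ} {s : RamState} (hI : s.reg 3 = I + 1)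
    (hp : s.arr (k + 6) I = p) (h7 : s.reg 7 = 1)
    (h : s.arr 0 p = 0 ∨ ∃ l r, s.arr 0 p = l + 1 ∧ s.arr 1 p = r + 1 ∧
      (s.arr (k + 5) l = 0 → s.arr (k + 5) r = 0 → s.arr 0 l ≠ 0 ∧ s.arr 0 r ≠ 0) ∧
      s.arr (k + 5) l + s.arr (k + 5) r ≤ B) :
    ∃ t s', t ≤ 50 ∧ RamIter B 3 (roundBody k) s t s' ∧ s'.reg 3 = I ∧
      (∀ x, x ≠ 3 → x < 8 → s'.reg x = s.reg x) ∧ s'.arr = s.arr := by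
  rcases h with h0 | ⟨l, r, h0, h1, hf, hB⟩
  · have hs : (roundBody k).Safe B s := by
      simp [roundBody, RamProg.Safe, RamProg.block, RamProg.run, RamState.reg_setReg,
        RamState.arr_setReg, *]
    obtain ⟨t, ht, he⟩ := hs.exec
    refine ⟨t + 1, _, ?_, .single (by omega) he, ?_, ?_, ?_⟩
    · simp only [roundBody, absorbProg, RamProg.len, RamProg.block] at ht; omega
    · simp [roundBody, RamProg.block, RamProg.run, RamState.reg_setReg, RamState.arr_setReg, *]
    · intro x x3 x8
      have : x ≠ 8 ∧ x ≠ 9 := by omega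
      simp [roundBody, RamProg.block, RamProg.run, RamState.reg_setReg, RamState.arr_setReg, *]
    · simp [roundBody, RamProg.block, RamProg.run, RamState.reg_setReg, RamState.arr_setReg, *]
  · by_cases hz : s.arr (k + 5) l = 0 ∧ s.arr (k + 5) r = 0
    · obtain ⟨hl, hr⟩ := hz
      obtain ⟨hl0, hr0⟩ := hf hl hr
      have hs : (roundBody k).Safe B s := by
        simp [roundBody, RamProg.Safe, RamProg.block, RamProg.run, RamState.reg_setReg,
          RamState.arr_setReg, *]
      obtain ⟨t, ht, he⟩ := hs.exec
      refine ⟨t + 1, _, ?_, .single (by omega) he, ?_, ?_, ?_⟩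
      · simp only [roundBody, absorbProg, RamProg.len, RamProg.block] at ht; omega
      · simp [roundBody, RamProg.block, RamProg.run, RamState.reg_setReg, RamState.arr_setReg, *]
      · intro x x3 x8
        have : x ≠ 8 ∧ x ≠ 9 ∧ x ≠ 10 ∧ x ≠ 11 ∧ x ≠ 12 := by omega
        simp [roundBody, RamProg.block, RamProg.run, RamState.reg_setReg, RamState.arr_setReg, *]
      · simp [roundBody, RamProg.block, RamProg.run, RamState.reg_setReg, RamState.arr_setReg, *]
    · have hz' : s.arr (k + 5) l = 0 → ¬ s.arr (k + 5) r = 0 := fun h h' => hz ⟨h, h'⟩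
      clear hf hz
      have hs : (roundBody k).Safe B s := by
        simp [roundBody, RamProg.Safe, RamProg.block, RamProg.run, RamState.reg_setReg,
          RamState.arr_setReg, *]
        tauto
      obtain ⟨t, ht, he⟩ := hs.exec
      refine ⟨t + 1, _, ?_, .single (by omega) he, ?_, ?_, ?_⟩
      · simp only [roundBody, absorbProg, RamProg.len, RamProg.block] at ht; omega
      · simp [roundBody, RamProg.block, RamProg.run, RamState.reg_setReg, RamState.arr_setReg, *]
        rw [if_pos hz']
        simp [RamState.reg_setReg, *]
      · intro x x3 x8
        have : x ≠ 8 ∧ x ≠ 9 ∧ x ≠ 10 ∧ x ≠ 11 ∧ x ≠ 12 := by omega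
        simp [roundBody, RamProg.block, RamProg.run, RamState.reg_setReg, RamState.arr_setReg, *]
        rw [if_pos hz']
        simp [RamState.reg_setReg, *]
      · simp [roundBody, RamProg.block, RamProg.run, RamState.reg_setReg, RamState.arr_setReg, *]
        rw [if_pos hz']
        simp [RamState.arr_setReg, *]

/-! ### Stored clusters and the cells that a round may change -/

/-- The child pointers and the labels of the nodes of the tree of the cluster that are not leaves are
in the arrays `0`, `1`, `k + 2` and `k + 3`. -/
def Cluster.Stored (k : ℕ) (s : RamState) : Cluster → Prop
  | single _ => True
  | comb a sd P L S => s.arr 0 a = a + 1 + 1 ∧ s.arr 1 a = S.toTree.root + 1 ∧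
      s.arr 0 (a + 1) = P.toTree.root + 1 ∧ s.arr 1 (a + 1) = L.toTree.root + 1 ∧
      s.arr (k + 2) a = (bif sd then 1 else 0) ∧ s.arr (k + 3) a = (bif sd then 0 else 1) ∧
      s.arr (k + 2) (a + 1) = 0 ∧ s.arr (k + 3) (a + 1) = 0 ∧
      P.Stored k s ∧ L.Stored k s ∧ S.Stored k s

/-- The configurations `s` and `s'` agree on the arrays that do not concern a tree of clusters, and in
the cells of these arrays with addresses below `f` or from `f'` on that are not in `N`. -/
structure RamFrame (k : ℕ) (N : List ℕ) (f f' : ℕ) (s s' : RamState) : Prop where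
  other : ∀ a, 2 ≤ a → a < k + 2 ∨ k + 5 < a → s'.arr a = s.arr a
  cell : ∀ a x, x ∉ N → x < f ∨ f' ≤ x → s'.arr a x = s.arr a x
  label : ∀ x < f, s'.arr (k + 2) x = s.arr (k + 2) x ∧ s'.arr (k + 3) x = s.arr (k + 3) x

theorem RamFrame.trans {k f f₁ f₂ : ℕ} {N₁ N₂ N : List ℕ} {s s₁ s₂ : RamState}
    (h : RamFrame k N₁ f f₁ s s₁) (h' : RamFrame k N₂ f₁ f₂ s₁ s₂) (h₁ : N₁ ⊆ N) (h₂ : N₂ ⊆ N)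
    (hf : f ≤ f₁) (hf' : f₁ ≤ f₂) : RamFrame k N f f₂ s s₂ where
  other a ha ha' := (h'.other a ha ha').trans (h.other a ha ha')
  cell a x hx hx' := (h'.cell a x (fun hn => hx (h₂ hn)) (by omega)).trans
    (h.cell a x (fun hn => hx (h₁ hn)) (by omega))
  label x hx := ⟨(h'.label x (by omega)).1.trans (h.label x hx).1,
    (h'.label x (by omega)).2.trans (h.label x hx).2⟩

theorem RamFrame.of_eq {k f f' : ℕ} {N : List ℕ} {s s' : RamState} (h : s'.arr = s.arr) :
    RamFrame k N f f' s s' := by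
  constructor <;> simp [h]

theorem Cluster.Stored.congr {k n f : ℕ} {s s' : RamState} {c : Cluster} (h : c.Stored k s)
    (hc : c.InRange n f) (hs : ∀ x, n ≤ x → x < f → ∀ a, a = 0 ∨ a = 1 ∨ a = k + 2 ∨ a = k + 3 →
      s'.arr a x = s.arr a x) : c.Stored k s' := by
  induction c with
  | single v => trivial
  | comb a sd P L S ihP ihL ihS =>
    obtain ⟨c1, c2, c3, c4, c5⟩ := hc
    have ha := hs a (by omega) (by omega)
    have hb := hs (a + 1) (by omega) (by omega)
    obtain ⟨h1, h2, h3, h4, h5, h6, h7, h8, h9, h10, h11⟩ := h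
    refine ⟨?_, ?_, ?_, ?_, ?_, ?_, ?_, ?_, ihP h9 c3, ihL h10 c4, ihS h11 c5⟩
    · rw [ha _ (by simp), h1]
    · rw [ha _ (by simp), h2]
    · rw [hb _ (by simp), h3]
    · rw [hb _ (by simp), h4]
    · rw [ha _ (by simp), h5]
    · rw [ha _ (by simp), h6]
    · rw [hb _ (by simp), h7]
    · rw [hb _ (by simp), h8]

theorem Cluster.InRange.root_lt {n f : ℕ} {c : Cluster} (hc : c.InRange n f) (h : n ≤ f) :
    c.toTree.root < f := by
  cases c with
  | single v => exact lt_of_lt_of_le hc h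
  | comb a sd P L S => exact (Nat.lt_succ_self a).trans hc.2.1

theorem AbsorbStep.frame {k f p l q : ℕ} {sd : Bool} {s s' : RamState}
    (h : AbsorbStep k f sd p l q s s') : RamFrame k [p] f (f + 2) s s' where
  other a ha ha' := h.arr_other a (by omega) (by omega) (by cases sd <;> simp <;> omega) (by omega)
    (by omega)
  cell a x hx hx' := by
    rw [List.mem_singleton] at hx
    have hxf : x ≠ f ∧ x ≠ f + 1 := by omega
    by_cases h0 : a = 0
    · subst h0; simp [h.arr_zero, Function.update_of_ne, *]
    by_cases h1 : a = 1
    · subst h1; simp [h.arr_one, Function.update_of_ne, *]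
    by_cases h2 : a = bif sd then k + 2 else k + 3
    · subst h2; rw [h.arr_label, Function.update_of_ne hxf.1]
    by_cases h3 : a = k + 4
    · subst h3; rw [h.arr_root, Function.update_of_ne hx]
    by_cases h4 : a = k + 5
    · subst h4; rw [h.arr_flag, Function.update_of_ne hx]
    rw [h.arr_other a h0 h1 h2 h3 h4]
  label x hx := by
    have h1 := h.arr_label
    cases sd
    · have h2 := h.arr_other (k + 2) (by omega) (by omega) (by simp) (by omega) (by omega)
      simp only [cond_false] at h1
      rw [h1, h2, Function.update_of_ne (by omega)]
      exact ⟨rfl, rfl⟩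
    · have h2 := h.arr_other (k + 3) (by omega) (by omega) (by simp) (by omega) (by omega)
      simp only [cond_true] at h1
      rw [h1, h2, Function.update_of_ne (by omega)]
      exact ⟨rfl, rfl⟩

namespace ClusterTree

theorem Pointers.root {k : ℕ} {s : RamState} {W : ClusterTree} (h : W.Pointers k s) :
    W.root + s.arr (k + 4) W.root = W.cluster.toTree.root := by
  cases W with
  | leaf v c => exact h.2
  | node v c l r => exact h.2.2.1

theorem Pointers.isLeaf_iff {k : ℕ} {s : RamState} {W : ClusterTree} (h : W.Pointers k s) :
    s.arr 0 W.root = 0 ↔ W.IsLeaf := by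
  cases W with
  | leaf v c => simp [IsLeaf, ClusterTree.root, h.1]
  | node v c l r => simp [IsLeaf, ClusterTree.root, h.1]

theorem Pointers.frame {k f f' : ℕ} {N : List ℕ} {s s' : RamState} {W : ClusterTree}
    (h : W.Pointers k s) (hf : RamFrame k N f f' s s') (hN : ∀ v ∈ W.nodes, v ∉ N ∧ v < f) :
    W.Pointers k s' :=
  h.congr fun v hv => ⟨hf.cell _ _ (hN v hv).1 (Or.inl (hN v hv).2),
    hf.cell _ _ (hN v hv).1 (Or.inl (hN v hv).2), hf.cell _ _ (hN v hv).1 (Or.inl (hN v hv).2)⟩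

/-- Work on the contracted tree changes cells of old nodes, below `n`, or cells that are still
fresh. A stored cluster lives between the two, so it is never disturbed although both structures
share the pointer arrays. -/
theorem stored_frame {k n f f₁ f₂ : ℕ} {N : List ℕ} {s s' : RamState} {c : Cluster}
    (h : c.Stored k s) (hc : c.InRange n f) (hf : RamFrame k N f₁ f₂ s s') (hN : ∀ v ∈ N, v < n)
    (h₁ : f ≤ f₁) : c.Stored k s' :=
  h.congr hc fun x hx hx' a _ => hf.cell a x (fun hv => absurd (hN x hv) (by omega)) (by omega)

theorem All.and {p q : Cluster → Prop} {W : ClusterTree} (hp : W.All p) (hq : W.All q) :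
    W.All fun c => p c ∧ q c := by
  induction W with
  | leaf v c => exact ⟨hp, hq⟩
  | node v c l r ihl ihr => exact ⟨⟨hp.1, hq.1⟩, ihl hp.2.1 hq.2.1, ihr hp.2.2 hq.2.2⟩

theorem All.stored_frame {k n f f₁ f₂ : ℕ} {N : List ℕ} {s s' : RamState} {W : ClusterTree}
    (h : W.All (Cluster.Stored k s)) (hc : W.All (Cluster.InRange n f))
    (hf : RamFrame k N f₁ f₂ s s') (hN : ∀ v ∈ N, v < n) (h₁ : f ≤ f₁) :
    W.All (Cluster.Stored k s') :=
  (h.and hc).mono fun _ hc => ClusterTree.stored_frame hc.1 hc.2 hf hN h₁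

theorem Pointers.absorb {k f p w : ℕ} {sd : Bool} {c cl : Cluster} {q : ClusterTree}
    {s s' : RamState} (hq : q.Pointers k s) (h : AbsorbStep k f sd p w q.root s s')
    (hN : ∀ v ∈ q.nodes, v ≠ p ∧ v < f) (hp : p < f) :
    (ClusterTree.absorb f sd p c cl q).Pointers k s' := by
  have h4 : p + s'.arr (k + 4) p = f := by
    rw [h.arr_root, Function.update_self]; omega
  have h0 : s'.arr 0 p = s.arr 0 q.root := by simp [h.arr_zero]
  have h1 : s'.arr 1 p = s.arr 1 q.root := by simp [h.arr_one]
  cases q with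
  | leaf v cq => exact ⟨h0.trans hq.1, h4⟩
  | node v cq l r =>
    refine ⟨h0.trans hq.1, h1.trans hq.2.1, h4, hq.2.2.2.1.frame h.frame ?_,
      hq.2.2.2.2.frame h.frame ?_⟩
    · intro x hx
      simpa using hN x (by simp [nodes, hx])
    · intro x hx
      simpa using hN x (by simp [nodes, hx])

/-- The program writes only one mark, at `f`. The other three mark cells of the two new nodes are
right because `hz` provides zeros in all unused cells. -/
theorem stored_comb {k n f p w q : ℕ} {sd : Bool} {c cl cq : Cluster} {s s' : RamState}
    (h : AbsorbStep k f sd p w q s s') (hp : p < n) (hn : n ≤ f)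
    (hc : p + s.arr (k + 4) p = c.toTree.root) (hcl : w + s.arr (k + 4) w = cl.toTree.root)
    (hcq : q + s.arr (k + 4) q = cq.toTree.root)
    (hz : ∀ x, f ≤ x → s.arr (k + 2) x = 0 ∧ s.arr (k + 3) x = 0)
    (hs : (c.Stored k s ∧ cl.Stored k s ∧ cq.Stored k s))
    (hr : (c.InRange n f ∧ cl.InRange n f ∧ cq.InRange n f)) :
    (Cluster.comb f sd c cl cq).Stored k s' := by
  have hpn : ∀ v ∈ [p], v < n := by simpa using hp
  have hfp : f ≠ p := by omega
  have hfp' : f + 1 ≠ p := by omega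
  have z1 := hz f le_rfl
  have z2 := hz (f + 1) (by omega)
  have hl := h.arr_label
  refine ⟨?_, ?_, ?_, ?_, ?_, ?_, ?_, ?_, stored_frame hs.1 hr.1 h.frame hpn le_rfl,
    stored_frame hs.2.1 hr.2.1 h.frame hpn le_rfl, stored_frame hs.2.2 hr.2.2 h.frame hpn le_rfl⟩
  · simp [h.arr_zero, Function.update_of_ne, hfp]
  · simp [h.arr_one, Function.update_of_ne, hfp, hcq]
  · simp [h.arr_zero, Function.update_of_ne, hfp', hc]
  · simp [h.arr_one, Function.update_of_ne, hfp', hcl]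
  all_goals
    cases sd
    · have h2 := h.arr_other (k + 2) (by omega) (by omega) (by simp) (by omega) (by omega)
      simp only [cond_false] at hl
      simp [hl, h2, z1, z2]
    · have h2 := h.arr_other (k + 3) (by omega) (by omega) (by simp) (by omega) (by omega)
      simp only [cond_true] at hl
      simp [hl, h2, z1, z2]

end ClusterTree

/-- Reading a preorder list from its end treats the second subtree, then the first, then the root;
this is the order in which `round` hands on the least unused identifier. The frame condition lets
the results for one subtree survive the work on the other and on the root. -/
theorem roundBody_iter {k B n : ℕ} (W : ClusterTree) {s : RamState} {f I : ℕ}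
    (hW : W.Pointers k s) (hs : W.All (Cluster.Stored k s)) (hr : W.All (Cluster.InRange n f))
    (hn : ∀ v ∈ W.nodes, v < n) (hd : W.nodes.Nodup) (hf : n ≤ f)
    (hflag : ∀ v ∈ W.nodes, s.arr (k + 5) v = 0)
    (hz : ∀ x, f ≤ x → s.arr (k + 2) x = 0 ∧ s.arr (k + 3) x = 0)
    (h3 : s.reg 3 = I + W.nodes.length) (hL : ArrList (s.arr (k + 6)) I W.nodes)
    (h2 : s.reg 2 = f) (h7 : s.reg 7 = 1) (hB : (W.round f).2.1 + 2 ≤ B) :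
    ∃ t s', t ≤ 50 * W.nodes.length ∧ RamIter B 3 (roundBody k) s t s' ∧ s'.reg 3 = I ∧
      s'.reg 2 = (W.round f).2.1 ∧ (∀ x, x ≠ 2 → x ≠ 3 → x < 8 → s'.reg x = s.reg x) ∧
      (W.round f).1.Pointers k s' ∧ (W.round f).1.All (Cluster.Stored k s') ∧
      s'.arr (k + 5) W.root = (if (W.round f).2.2 then 1 else 0) ∧
      RamFrame k W.nodes f (W.round f).2.1 s s' := by
  induction W generalizing s f I with
  | leaf v c =>
    simp only [ClusterTree.nodes, List.length_singleton, ClusterTree.root] at *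
    obtain ⟨t, s', ht, he, r3, hreg, harr⟩ :=
      roundBody_skip (B := B) h3 hL.1 h7 (Or.inl hW.1)
    have hframe : RamFrame k [v] f f s s' := .of_eq harr
    refine ⟨t, s', by omega, he, r3, (hreg 2 (by omega) (by omega)).trans h2,
      fun x _ hx hx' => hreg x hx hx', ?_, ?_, ?_, hframe⟩
    · exact hW.congr fun v _ => by simp only [harr, and_self]
    · exact hs.stored_frame hr hframe hn le_rfl
    · rw [harr]
      exact hflag v (List.mem_singleton_self v)
  | node v c l r ihl ihr =>
    obtain ⟨p0, p1, p4, pl, pr⟩ := hW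
    obtain ⟨sc, sl, sr⟩ := hs
    obtain ⟨rc, rl, rr⟩ := hr
    simp only [ClusterTree.nodes, List.length_cons, List.length_append, ClusterTree.root,
      List.nodup_cons, List.mem_append, not_or, List.nodup_append, List.mem_cons, or_imp,
      forall_and, forall_eq] at hn hd hflag h3 hL ⊢
    obtain ⟨hL1, hL2⟩ := hL
    rw [arrList_append] at hL2
    obtain ⟨hnv, hnl, hnr⟩ := hn
    obtain ⟨⟨hvl, hvr⟩, hdl, hdr, hlr⟩ := hd
    obtain ⟨hfv, hfl, hfr⟩ := hflag
    have hf1 := r.le_round f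
    have hf2 := l.le_round (r.round f).2.1
    -- The counter never decreases, so the word bound for the whole tree covers both subtrees.
    have hf3 : (l.round (r.round f).2.1).2.1 ≤ ((ClusterTree.node v c l r).round f).2.1 := by
      rw [ClusterTree.round]
      rcases ClusterTree.join_cases (l.round (r.round f).2.1).2.1 v c (l.round (r.round f).2.1).2.2
        (r.round f).2.2 (l.round (r.round f).2.1).1 (r.round f).1 with
        ⟨_, _, w, cl, _, h⟩ | ⟨_, _, _, w, cl, _, h⟩ | ⟨_, h⟩ <;> rw [h] <;> simp
    -- the second subtree
    obtain ⟨t, s₁, ht, he, a3, a2, areg, aptr, ast, aflag, afr⟩ :=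
      ihr (s := s) (f := f) (I := I + 1 + l.nodes.length) pr sr rr hnr hdr hf hfr hz (by omega)
        hL2.2 h2 h7 (by omega)
    -- the first subtree
    have hlN : ∀ x ∈ l.nodes, x ∉ r.nodes ∧ x < f := fun x hx =>
      ⟨fun hx' => hlr x hx x hx' rfl, (hnl x hx).trans_le hf⟩
    obtain ⟨t', s₂, ht', he', b3, b2, breg, bptr, bst, bflag, bfr⟩ :=
      ihl (s := s₁) (f := (r.round f).2.1) (I := I + 1) (pl.frame afr hlN)
        (sl.stored_frame rl afr hnr le_rfl) (rl.mono fun c hc => hc.mono hf1) hnl hdl (by omega)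
        (fun x hx => by
          rw [afr.cell _ _ (hlN x hx).1 (Or.inl (hlN x hx).2)]; exact hfl x hx)
        (fun x hx => by
          have hxr : x ∉ r.nodes := fun hx' => absurd (hnr x hx') (by omega)
          rw [afr.cell _ _ hxr (Or.inr hx), afr.cell _ _ hxr (Or.inr hx)]
          exact hz x (by omega))
        (by omega) (by rw [afr.other _ (by omega) (by omega)]; exact hL2.1) a2
        (by rw [areg 7 (by omega) (by omega) (by omega), h7]) (by omega)
    -- the root
    have hfr2 : RamFrame k (l.nodes ++ r.nodes) f (l.round (r.round f).2.1).2.1 s s₂ :=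
      afr.trans bfr (by simp) (by simp) hf1 hf2
    have hvn : v ∉ l.nodes ++ r.nodes := by simp [hvl, hvr]
    have hvf : v < f := by omega
    have hNn : ∀ x ∈ l.nodes ++ r.nodes, x < n := by
      intro x hx
      rcases List.mem_append.1 hx with hx | hx
      exacts [hnl x hx, hnr x hx]
    have hcell : ∀ a, s₂.arr a v = s.arr a v := fun a => hfr2.cell a v hvn (Or.inl hvf)
    have hrl : ∀ x ∈ r.nodes, x ∉ l.nodes ∧ x < (r.round f).2.1 := fun x hx =>
      ⟨fun hx' => hlr x hx' x hx rfl, by have := hnr x hx; omega⟩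
    have hrsub := (r.nodes_round_sublist f).subset
    have hlsub := (l.nodes_round_sublist (r.round f).2.1).subset
    have rr' := ClusterTree.inRange_round rr hf
    have rl' := ClusterTree.inRange_round (rl.mono fun c hc => hc.mono hf1) (hf.trans hf1)
    have rptr : (r.round f).1.Pointers k s₂ := aptr.frame bfr fun x hx => hrl x (hrsub hx)
    have rst : (r.round f).1.All (Cluster.Stored k s₂) := ast.stored_frame rr' bfr hnl le_rfl
    have rflag : s₂.arr (k + 5) r.root = if (r.round f).2.2 then 1 else 0 := by
      rw [bfr.cell _ _ (hrl _ r.root_mem_nodes).1 (Or.inl (hrl _ r.root_mem_nodes).2), aflag]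
    have cst : c.Stored k s₂ := ClusterTree.stored_frame sc rc hfr2 hNn le_rfl
    have hz2 : ∀ x, (l.round (r.round f).2.1).2.1 ≤ x →
        s₂.arr (k + 2) x = 0 ∧ s₂.arr (k + 3) x = 0 := fun x hx => by
      have hxn : x ∉ l.nodes ++ r.nodes := fun hx' => absurd (hNn x hx') (by omega)
      rw [hfr2.cell _ _ hxn (Or.inr hx), hfr2.cell _ _ hxn (Or.inr hx)]
      exact hz x (by omega)
    have hL1' : s₂.arr (k + 6) I = v := by rw [hfr2.other _ (by omega) (by omega)]; exact hL1
    have h7' : s₂.reg 7 = 1 := by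
      rw [breg 7 (by omega) (by omega) (by omega), areg 7 (by omega) (by omega) (by omega), h7]
    have hroot := r.root_round f
    have hroot' := l.root_round (r.round f).2.1
    have hrr := rptr.root
    have hlr' := bptr.root
    have hlt := rl'.cluster.root_lt (by omega)
    have hlt' := rr'.cluster.root_lt (by omega)
    have hil := bptr.isLeaf_iff
    have hir := rptr.isLeaf_iff
    rw [hroot] at hrr hir
    rw [hroot'] at hlr' hil
    have hlroot := l.root_mem_nodes
    have hrroot := r.root_mem_nodes
    have hlroot' := hnl _ hlroot
    have hrroot' := hnr _ hrroot
    have rr2 := rr'.mono fun c hc => Cluster.InRange.mono hc hf2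
    have rc2 := rc.mono (hf1.trans hf2)
    -- Common to both absorbing cases: `w` and `cl` belong to the leaf, and `q` is the other child
    -- after its own round.
    have key : ∀ (sd : Bool) (q : ClusterTree) (w : ℕ) (cl : Cluster) (s₃ : RamState),
        AbsorbStep k (l.round (r.round f).2.1).2.1 sd v w q.root s₂ s₃ → q.Pointers k s₂ →
        q.All (Cluster.Stored k s₂) → q.All (Cluster.InRange n (l.round (r.round f).2.1).2.1) →
        q.nodes ⊆ l.nodes ++ r.nodes → w + s₂.arr (k + 4) w = cl.toTree.root → cl.Stored k s₂ →
        cl.InRange n (l.round (r.round f).2.1).2.1 →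
        (ClusterTree.absorb (l.round (r.round f).2.1).2.1 sd v c cl q).Pointers k s₃ ∧
        (ClusterTree.absorb (l.round (r.round f).2.1).2.1 sd v c cl q).All (Cluster.Stored k s₃) ∧
        s₃.arr (k + 5) v = 1 ∧ RamFrame k (v :: (l.nodes ++ r.nodes)) f
          ((l.round (r.round f).2.1).2.1 + 2) s s₃ := by
      intro sd q w cl s₃ hstep qp qs qr qn hw cls clr
      refine ⟨qp.absorb hstep ?_ (by omega), ?_, by simp [hstep.arr_flag],
        hfr2.trans hstep.frame (by simp) (by simp) (hf1.trans hf2) (by omega)⟩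
      · intro x hx
        refine ⟨?_, by have := hNn x (qn hx); omega⟩
        rintro rfl
        exact hvn (qn hx)
      · refine ClusterTree.All.absorb (qs.stored_frame qr hstep.frame (by simpa using hnv) le_rfl) ?_
        exact ClusterTree.stored_comb hstep hnv (by omega) (by rw [hcell, p4]) hw qp.root hz2
          ⟨cst, cls, qs.cluster⟩ ⟨rc2, clr, qr.cluster⟩
    rw [ClusterTree.round] at hB ⊢
    rcases ClusterTree.join_cases (l.round (r.round f).2.1).2.1 v c (l.round (r.round f).2.1).2.2
      (r.round f).2.2 (l.round (r.round f).2.1).1 (r.round f).1 with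
      ⟨j1, j2, w, cl, j3, j⟩ | ⟨j1, j2, j5, w, cl, j3, j⟩ | ⟨j1, j⟩ <;> rw [j] at hB ⊢
    · simp only at hB
      obtain ⟨t'', s₃, ht'', he'', c3, c2, creg, hstep⟩ :=
        roundBody_absorb (B := B) (sd := true) b3 hL1' b2 h7' (by rw [hcell, p0])
          (by rw [hcell, p1]) (by rw [bflag, j1]; rfl) (by rw [rflag, j2]; rfl)
          (hil.2 (by rw [j3]; trivial)) (by omega) (by omega) (by omega)
          (by rw [hcell, p4]; exact rc2.root_lt (by omega)) (by omega) (by omega)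
      simp only [cond_true] at hstep
      have := key true (r.round f).1 l.root cl s₃ (by rwa [hroot]) rptr rst rr2
        (List.Subset.trans hrsub (by simp)) (by rw [hlr', j3]; rfl) (by rw [j3] at bst; exact bst)
        (by rw [j3] at rl'; exact rl')
      refine ⟨t + (t' + t''), s₃, by omega, he.trans (he'.trans he''), c3, c2, ?_, this.1, this.2.1,
        this.2.2.1, this.2.2.2⟩
      intro x x2 x3 x8
      rw [creg x x2 x3 x8, breg x x2 x3 x8, areg x x2 x3 x8]
    · have hl0 : s₂.arr 0 l.root ≠ 0 := fun h0 => j5 (hil.1 h0)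
      simp only at hB
      obtain ⟨t'', s₃, ht'', he'', c3, c2, creg, hstep⟩ :=
        roundBody_absorb (B := B) (sd := false) b3 hL1' b2 h7' (by rw [hcell, p0])
          (by rw [hcell, p1]) (by rw [bflag, j1]; rfl) (by rw [rflag, j2]; rfl)
          ⟨hl0, hir.2 (by rw [j3]; trivial)⟩ (by omega) (by omega) (by omega)
          (by rw [hcell, p4]; exact rc2.root_lt (by omega)) (by omega) (by omega)
      simp only [cond_false] at hstep
      have := key false (l.round (r.round f).2.1).1 r.root cl s₃ (by rwa [hroot']) bptr bst rl'
        (List.Subset.trans hlsub (by simp)) (by rw [hrr, j3]; rfl) (by rw [j3] at rst; exact rst)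
        (by rw [j3] at rr2; exact rr2)
      refine ⟨t + (t' + t''), s₃, by omega, he.trans (he'.trans he''), c3, c2, ?_, this.1, this.2.1,
        this.2.2.1, this.2.2.2⟩
      intro x x2 x3 x8
      rw [creg x x2 x3 x8, breg x x2 x3 x8, areg x x2 x3 x8]
    · have hleaf : s₂.arr (k + 5) l.root = 0 → s₂.arr (k + 5) r.root = 0 →
          s₂.arr 0 l.root ≠ 0 ∧ s₂.arr 0 r.root ≠ 0 := by
        intro hl0 hr0
        rw [bflag] at hl0
        rw [rflag] at hr0
        have := j1 (by simpa using hl0) (by simpa using hr0)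
        exact ⟨fun h => this.1 (hil.1 h), fun h => this.2 (hir.1 h)⟩
      -- The program adds the two flags to test both at once; each is at most 1, and `B` is at least
      -- 2.
      have hsum : s₂.arr (k + 5) l.root + s₂.arr (k + 5) r.root ≤ B := by
        rw [bflag, rflag]
        simp only at hB
        split_ifs <;> omega
      obtain ⟨t'', s₃, ht'', he'', c3, creg, carr⟩ :=
        roundBody_skip (B := B) b3 hL1' h7' (Or.inr ⟨l.root, r.root, by rw [hcell, p0],
          by rw [hcell, p1], hleaf, hsum⟩)
      have hfr3 : RamFrame k [] (l.round (r.round f).2.1).2.1 (l.round (r.round f).2.1).2.1 s₂ s₃ :=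
        .of_eq carr
      refine ⟨t + (t' + t''), s₃, by omega, he.trans (he'.trans he''), c3,
        (creg 2 (by omega) (by omega)).trans b2, ?_, ?_, ?_, ?_,
        hfr2.trans hfr3 (by simp) (by simp) (hf1.trans hf2) le_rfl⟩
      · intro x x2 x3 x8
        rw [creg x x3 x8, breg x x2 x3 x8, areg x x2 x3 x8]
      · refine ⟨?_, ?_, ?_, bptr.congr fun x _ => by simp only [carr, and_self],
          rptr.congr fun x _ => by simp only [carr, and_self]⟩
        · rw [carr, hcell, p0, hroot']
        · rw [carr, hcell, p1, hroot]
        · rw [carr, hcell, p4]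
      · exact ⟨ClusterTree.stored_frame cst rc2 hfr3 (by simp) le_rfl,
          bst.stored_frame rl' hfr3 (by simp) le_rfl, rst.stored_frame rr2 hfr3 (by simp) le_rfl⟩
      · rw [carr, hcell]
        simpa using hfv

/-! ### Repeated rounds -/

namespace ClusterTree

/-- A tree of clusters and the least unused identifier after one more round. -/
def roundPair (x : ClusterTree × ℕ) : ClusterTree × ℕ := ((x.1.round x.2).1, (x.1.round x.2).2.1)

theorem IsLeaf.roundPair_eq {x : ClusterTree × ℕ} (h : x.1.IsLeaf) : roundPair x = x := by
  simp only [roundPair, h.round_eq]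

theorem leaves_roundPair (x : ClusterTree × ℕ) :
    (x.1.leaves = 1 ∧ (roundPair x).1.leaves = 1) ∨
      4 * (roundPair x).1.leaves ≤ 3 * x.1.leaves := by
  by_cases h : x.1.IsLeaf
  · rw [h.roundPair_eq]
    exact Or.inl ⟨h.leaves_eq, h.leaves_eq⟩
  · exact Or.inr ((Nat.le_add_right _ _).trans (leaves_round_le x.1 x.2 h).1)

/-- Three rounds at least halve the number of leaves, because `27/64 < 1/2`, unless a single leaf is
already left, which further rounds do not change. -/
theorem isLeaf_iterate (j : ℕ) (x : ClusterTree × ℕ) (h : x.1.leaves ≤ 2 ^ j) :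
    (roundPair^[3 * j] x).1.IsLeaf := by
  induction j generalizing x with
  | zero =>
    have := x.1.leaves_pos
    exact isLeaf_iff.2 (by simpa using le_antisymm h this)
  | succ j ih =>
    rw [show 3 * (j + 1) = 3 * j + 1 + 1 + 1 by ring, Function.iterate_succ_apply,
      Function.iterate_succ_apply, Function.iterate_succ_apply]
    apply ih
    have h1 := leaves_roundPair x
    have h2 := leaves_roundPair (roundPair x)
    have h3 := leaves_roundPair (roundPair (roundPair x))
    have := Nat.one_le_two_pow (n := j)
    rw [pow_succ] at h
    omega

theorem iterate_spec (W : ClusterTree) (n N : ℕ) (hr : W.All (Cluster.InRange n n))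
    (hh : W.All fun c => c.toTree.height ≤ 0) :
    (roundPair^[N] (W, n)).1.ids + Multiset.range n =
        W.ids + Multiset.range (roundPair^[N] (W, n)).2 ∧
      (∀ i u v, (roundPair^[N] (W, n)).1.Edge i u v ↔ W.Edge i u v) ∧
      n ≤ (roundPair^[N] (W, n)).2 ∧
      (roundPair^[N] (W, n)).1.All (Cluster.InRange n (roundPair^[N] (W, n)).2) ∧
      ((roundPair^[N] (W, n)).1.All fun c => c.toTree.height ≤ 2 * N) ∧
      (roundPair^[N] (W, n)).2 + 2 * (roundPair^[N] (W, n)).1.leaves = n + 2 * W.leaves := by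
  induction N with
  | zero => exact ⟨rfl, fun _ _ _ => Iff.rfl, le_rfl, hr, hh, rfl⟩
  | succ N ih =>
    rw [Function.iterate_succ_apply']
    obtain ⟨h1, h2, h3, h4, h5, h6⟩ := ih
    set x := roundPair^[N] (W, n)
    refine ⟨?_, fun i u v => (edge_round x.1 x.2).trans (h2 i u v), h3.trans (le_round x.1 x.2),
      inRange_round h4 h3, (height_round h5 x.2).1, (leaves_round x.1 x.2).trans h6⟩
    have h7 := ids_round x.1 x.2
    ext y
    replace h1 := congrArg (Multiset.count y) h1
    replace h7 := congrArg (Multiset.count y) h7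
    simp only [Multiset.count_add, roundPair] at h1 h7 ⊢
    omega

theorem root_ofTree (T : BinTree) : (ofTree T).root = T.root := by
  cases T <;> rfl

theorem nodes_ofTree (T : BinTree) : (ofTree T).nodes = T.nodes := by
  induction T with
  | leaf v => rfl
  | node v l r ihl ihr => simp only [ofTree, nodes, BinTree.nodes, ihl, ihr]

theorem top_ofTree (T : BinTree) : (ofTree T).cluster.top = T.root := by
  cases T <;> rfl

theorem edge_ofTree (T : BinTree) (u v : ℕ) :
    ((ofTree T).Edge true u v ↔ T.Child1 u v) ∧ ((ofTree T).Edge false u v ↔ T.Child2 u v) := by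
  induction T with
  | leaf w => exact ⟨Iff.rfl, Iff.rfl⟩
  | node w l r ihl ihr =>
    simp only [ofTree, Edge, Cluster.Edge, Cluster.port, top_ofTree, ihl, ihr, BinTree.Child1,
      BinTree.Child2, cond_true, cond_false, false_or]
    constructor <;> tauto

theorem ids_ofTree (T : BinTree) : (ofTree T).ids = T.nodes := by
  induction T with
  | leaf v => rfl
  | node v l r ihl ihr =>
    simp only [ofTree, ids, Cluster.ids, ihl, ihr, BinTree.nodes, ← Multiset.cons_coe,
      ← Multiset.coe_add, ← Multiset.singleton_add, add_assoc]

theorem all_ofTree {p : Cluster → Prop} {T : BinTree} (h : ∀ v ∈ T.nodes, p (.single v)) :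
    (ofTree T).All p := by
  induction T with
  | leaf v => exact h v (List.mem_singleton_self v)
  | node v l r ihl ihr =>
    simp only [BinTree.nodes, List.mem_cons, List.mem_append] at h
    exact ⟨h v (by simp), ihl fun w hw => h w (by simp [hw]), ihr fun w hw => h w (by simp [hw])⟩

end ClusterTree

/-- The program for one round. -/
def roundProg (k : ℕ) : RamProg :=
  .block [.store (k + 7) 5 1, .const 4 1, .const 3 0, .loop 4 (listBody k), .loop 3 (roundBody k),
    .load 6 0 1]

/-- The configuration `s` holds a tree of clusters `W` that is obtained from a tree with `n` nodes,
where `f` is the least unused identifier and the configuration `s₀` holds the labels. -/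
structure RamInv (k n : ℕ) (s₀ s : RamState) (W : ClusterTree) (f : ℕ) : Prop where
  pointers : W.Pointers k s
  stored : W.All (Cluster.Stored k s)
  inRange : W.All (Cluster.InRange n f)
  lt : ∀ v ∈ W.nodes, v < n
  nodup : W.nodes.Nodup
  le : n ≤ f
  leaves : f + 2 * W.leaves = 2 * n + 1
  unused : ∀ x, f ≤ x → s.arr (k + 2) x = 0 ∧ s.arr (k + 3) x = 0
  unlabeled : ∀ x < n, s.arr (k + 2) x = 0 ∧ s.arr (k + 3) x = 0
  labels : ∀ a, 2 ≤ a → a < k + 2 → s.arr a = s₀.arr a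
  reg_zero : s.reg 0 = n
  reg_one : s.reg 1 = W.root
  reg_two : s.reg 2 = f
  reg_five : s.reg 5 = 0
  reg_six : s.reg 6 = s.arr 0 W.root
  reg_seven : s.reg 7 = 1

/-- Listing costs at most 20 and absorbing at most 50 steps per node, and 7 further steps are
absorbed by the constant. The bound `2 * n + 1` on words suffices because the sum of the counter and
twice the number of leaves is always `2 * n + 1`, and at least one leaf remains. -/
theorem RamInv.round {k n f B : ℕ} {s₀ s : RamState} {W : ClusterTree} (h : RamInv k n s₀ s W f)
    (hB : 2 * n + 1 ≤ B) :
    ∃ t s', t ≤ 78 * W.nodes.length ∧ RamExec B (roundProg k) s t s' ∧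
      RamInv k n s₀ s' (W.round f).1 (W.round f).2.1 := by
  have hlen := W.length_nodes
  have hlen' := W.leaves_round f
  have hpos := W.leaves_pos
  have hpos' := (W.round f).1.leaves_pos
  have hle := h.leaves
  have hfn := h.le
  set s₁ := ((s.setArr (k + 7) 0 W.root).setReg 4 1).setReg 3 0 with hs₁
  have harr₁ : ∀ a, a < k + 7 → s₁.arr a = s.arr a := fun a ha => by
    simp [hs₁, RamState.arr_setReg, RamState.arr_setArr, show a ≠ k + 7 by omega]
  have hreg₁ : ∀ x, x ≠ 3 → x ≠ 4 → s₁.reg x = s.reg x := fun x h3 h4 => by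
    simp [hs₁, RamState.reg_setReg, RamState.reg_setArr, h3, h4]
  obtain ⟨t, s₂, ht, he, r4, r3, hreg₂, harr₂, hflag, hlist, -, -⟩ :=
    listBody_iter (B := B) W (s := s₁) (H := 0) (J := 0)
      (h.pointers.congr fun v _ => by
        simp only [harr₁ 0 (by omega), harr₁ 1 (by omega), harr₁ (k + 4) (by omega), and_self])
      (by simp [hs₁, RamState.reg_setReg])
      (by simp [hs₁, RamState.arr_setReg, RamState.arr_setArr]) (by simp [hs₁, RamState.reg_setReg])
      ((hreg₁ 5 (by omega) (by omega)).trans h.reg_five)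
      ((hreg₁ 7 (by omega) (by omega)).trans h.reg_seven) (by omega) (by omega)
  have harr : ∀ a, a < k + 5 → s₂.arr a = s.arr a := fun a ha =>
    (harr₂ a ha).trans (harr₁ a (by omega))
  have hreg : ∀ x, x ≠ 3 → x ≠ 4 → x < 8 → s₂.reg x = s.reg x := fun x h3 h4 h8 =>
    (hreg₂ x h3 h4 h8).trans (hreg₁ x h3 h4)
  obtain ⟨t', s₃, ht', he', q3, q2, hreg₃, hptr, hst, -, hfr⟩ :=
    roundBody_iter (B := B) W (s := s₂) (I := 0)
      (h.pointers.congr fun v _ => by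
        simp only [harr 0 (by omega), harr 1 (by omega), harr (k + 4) (by omega), and_self])
      ((h.stored.and h.inRange).mono fun c hc => hc.1.congr hc.2 fun x _ _ a ha => by
        rw [harr a (by omega)])
      h.inRange h.lt h.nodup h.le (fun v hv => hflag v (Or.inl hv))
      (fun x hx => by rw [harr _ (by omega), harr _ (by omega)]; exact h.unused x hx) r3 hlist
      ((hreg 2 (by omega) (by omega) (by omega)).trans h.reg_two)
      ((hreg 7 (by omega) (by omega) (by omega)).trans h.reg_seven) (by omega)
  have hreg' : ∀ x, x ≠ 2 → x ≠ 3 → x ≠ 4 → x < 8 → s₃.reg x = s.reg x := fun x h2 h3 h4 h8 =>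
    (hreg₃ x h2 h3 h8).trans (hreg x h3 h4 h8)
  have hr1 : s₃.reg 1 = W.root := (hreg' 1 (by omega) (by omega) (by omega) (by omega)).trans h.reg_one
  have e1 := RamExec.store (W := B) s (k + 7) 5 1
  rw [h.reg_five, h.reg_one] at e1
  refine ⟨1 + (1 + (1 + ((t + 1) + ((t' + 1) + (1 + 1))))), s₃.setReg 6 (s₃.arr 0 (s₃.reg 1)),
    by omega, .seq e1 (.seq (.const _ 4 1 (by omega)) (.seq (.const _ 3 0 (by omega))
      (.seq (he.exec r4) (.seq (he'.exec q3) (.seq (.load _ 6 0 1) (.skip _)))))), ?_⟩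
  have hN : ∀ x, (W.round f).2.1 ≤ x → x ∉ W.nodes := fun x hx hx' => by
    have := h.lt x hx'; have := W.le_round f; omega
  constructor
  · exact hptr.congr fun v _ => by simp only [RamState.arr_setReg, and_self]
  · exact (hst.and (ClusterTree.inRange_round h.inRange h.le)).mono fun c hc =>
      hc.1.congr hc.2 fun _ _ _ _ _ => rfl
  · exact ClusterTree.inRange_round h.inRange h.le
  · exact fun v hv => h.lt v ((W.nodes_round_sublist f).subset hv)
  · exact h.nodup.sublist (W.nodes_round_sublist f)
  · exact h.le.trans (W.le_round f)
  · omega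
  · intro x hx
    rw [RamState.arr_setReg, hfr.cell _ x (hN x hx) (Or.inr hx),
      hfr.cell _ x (hN x hx) (Or.inr hx), harr _ (by omega), harr _ (by omega)]
    exact h.unused x ((W.le_round f).trans hx)
  · intro x hx
    rw [RamState.arr_setReg, (hfr.label x (by omega)).1, (hfr.label x (by omega)).2,
      harr _ (by omega), harr _ (by omega)]
    exact h.unlabeled x hx
  · intro a ha ha'
    rw [RamState.arr_setReg, hfr.other a ha (Or.inl ha'), harr a (by omega), h.labels a ha ha']
  · rw [RamState.reg_setReg, if_neg (by omega), hreg' _ (by omega) (by omega) (by omega) (by omega),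
      h.reg_zero]
  · rw [RamState.reg_setReg, if_neg (by omega), hr1, W.root_round]
  · rw [RamState.reg_setReg, if_neg (by omega), q2]
  · rw [RamState.reg_setReg, if_neg (by omega), hreg' _ (by omega) (by omega) (by omega) (by omega),
      h.reg_five]
  · rw [RamState.reg_setReg, if_pos rfl, hr1, W.root_round]
    rfl
  · rw [RamState.reg_setReg, if_neg (by omega), hreg' _ (by omega) (by omega) (by omega) (by omega),
      h.reg_seven]

/-- A geometric series: a round on `w` nodes costs about `78 * w` and leaves at most `3 * w / 4`
nodes, so any constant `C` with `78 + 3 * C / 4 ≤ C` and some slack for the loop tests works. -/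
theorem RamInv.loop {k n B : ℕ} {s₀ s : RamState} (N : ℕ) {x : ClusterTree × ℕ}
    (h : RamInv k n s₀ s x.1 x.2) (hB : 2 * n + 1 ≤ B)
    (hN : (ClusterTree.roundPair^[N] x).1.IsLeaf) :
    ∃ t s', t ≤ 316 * x.1.nodes.length + 1 ∧ RamExec B (.loop 6 (roundProg k)) s t s' ∧
      RamInv k n s₀ s' (ClusterTree.roundPair^[N] x).1 (ClusterTree.roundPair^[N] x).2 := by
  induction N generalizing s x with
  | zero =>
    refine ⟨1, s, by omega, .loop_false ?_, h⟩
    rw [h.reg_six, h.pointers.isLeaf_iff]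
    exact hN
  | succ N ih =>
    rw [Function.iterate_succ_apply] at hN ⊢
    by_cases hx : x.1.IsLeaf
    -- `N` may exceed the number of rounds that the machine performs; the surplus iterations fix a
    -- single leaf.
    · rw [hx.roundPair_eq] at hN ⊢
      exact ih h hN
    · obtain ⟨t, s₁, ht, he, h₁⟩ := h.round hB
      obtain ⟨t', s₂, ht', he', h₂⟩ := ih (x := ClusterTree.roundPair x) h₁ hN
      refine ⟨t + t' + 1, s₂, ?_, .loop_true ?_ he he', h₂⟩
      · have h1 := x.1.length_nodes
        have h2 := (ClusterTree.roundPair x).1.length_nodes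
        have h3 := (ClusterTree.leaves_round_le x.1 x.2 hx).1
        simp only [ClusterTree.roundPair] at h2 ht'
        omega
      · rw [h.reg_six]
        exact fun h0 => hx (h.pointers.isLeaf_iff.1 h0)

/-! ### The program that builds the balanced tree -/

/-- Clear the child pointers of the nodes below the number in register `3`. -/
def clearBody : RamProg := .block [.sub 3 3 7, .store 0 3 5, .store 1 3 5]

/-- The old nodes end up as leaves of the balanced tree, but their cells may still hold pointers
from the input and the contraction. -/
theorem clearBody_iter {B n : ℕ} {s : RamState} (h3 : s.reg 3 = n) (h5 : s.reg 5 = 0)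
    (h7 : s.reg 7 = 1) :
    ∃ t s', t ≤ 5 * n ∧ RamIter B 3 clearBody s t s' ∧ s'.reg 3 = 0 ∧
      (∀ x, x ≠ 3 → s'.reg x = s.reg x) ∧ (∀ a, 2 ≤ a → s'.arr a = s.arr a) ∧
      ∀ a < 2, ∀ x, s'.arr a x = if x < n then 0 else s.arr a x := by
  induction n generalizing s with
  | zero => exact ⟨0, s, le_rfl, .refl s, h3, fun _ _ => rfl, fun _ _ => rfl, by simp⟩
  | succ n ih =>
    have hs : clearBody.Safe B s := by
      simp [clearBody, RamProg.block, RamProg.Safe]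
    obtain ⟨t, ht, he⟩ := hs.exec
    obtain ⟨t', s', ht', he', r3, hreg, harr, hcell⟩ := ih (s := clearBody.run s)
      (by simp [clearBody, RamProg.block, RamProg.run, RamState.reg_setReg, RamState.reg_setArr, *])
      (by simp [clearBody, RamProg.block, RamProg.run, RamState.reg_setReg, RamState.reg_setArr, *])
      (by simp [clearBody, RamProg.block, RamProg.run, RamState.reg_setReg, RamState.reg_setArr, *])
    refine ⟨t + t' + 1, s', ?_, .step (by omega) he he', r3, ?_, ?_, ?_⟩
    · simp only [clearBody, RamProg.block, RamProg.len] at ht; omega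
    · intro x hx
      rw [hreg x hx]
      simp [clearBody, RamProg.block, RamProg.run, RamState.reg_setReg, RamState.reg_setArr, hx]
    · intro a ha
      rw [harr a ha]
      simp [clearBody, RamProg.block, RamProg.run, RamState.arr_setReg, RamState.arr_setArr,
        show a ≠ 0 by omega, show a ≠ 1 by omega]
    · intro a ha x
      rw [hcell a ha x]
      have h01 : a = 0 ∨ a = 1 := by omega
      by_cases hx : x = n
      · subst hx
        rcases h01 with rfl | rfl <;>
          simp [clearBody, RamProg.block, RamProg.run, RamState.arr_setReg, RamState.arr_setArr,
            RamState.reg_setReg, RamState.reg_setArr, *]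
      · have : x < n + 1 ↔ x < n := by omega
        rcases h01 with rfl | rfl <;>
          simp [clearBody, RamProg.block, RamProg.run, RamState.arr_setReg, RamState.arr_setArr,
            RamState.reg_setReg, RamState.reg_setArr, Function.update_of_ne, *]

/-- The program that builds the balanced tree. -/
def buildProg (k : ℕ) : RamProg :=
  .block [.const 7 1, .add 2 0 5, .load 6 0 1, .loop 6 (roundProg k), .add 3 0 5, .loop 3 clearBody,
    .load 8 (k + 4) 1, .add 1 1 8, .add 0 2 5]

/-- Storing offsets to cluster roots rather than the roots themselves makes the initial value 0
correct for single nodes, so the array `k + 4` needs no initialization. -/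
theorem pointers_ofTree {k : ℕ} {s : RamState} {T : BinTree} (h : s.HoldsShape T)
    (h4 : ∀ v, s.arr (k + 4) v = 0) : (ClusterTree.ofTree T).Pointers k s := by
  induction T with
  | leaf v => exact ⟨h.1, by rw [h4]; rfl⟩
  | node v l r ihl ihr =>
    exact ⟨by rw [h.1, ClusterTree.root_ofTree], by rw [h.2.1, ClusterTree.root_ofTree],
      by rw [h4]; rfl, ihl h.2.2.1, ihr h.2.2.2⟩

theorem RamState.HoldsShape.congr {s s' : RamState} {T : BinTree} (h : s.HoldsShape T)
    (h0 : s'.arr 0 = s.arr 0) (h1 : s'.arr 1 = s.arr 1) : s'.HoldsShape T := by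
  induction T with
  | leaf v => exact ⟨h0 ▸ h.1, h1 ▸ h.2⟩
  | node v l r ihl ihr => exact ⟨h0 ▸ h.1, h1 ▸ h.2.1, ihl h.2.2.1, ihr h.2.2.2⟩

theorem Cluster.Stored.holdsShape {k n f : ℕ} {s : RamState} {c : Cluster} (h : c.Stored k s)
    (hc : c.InRange n f) (hz : ∀ v < n, s.arr 0 v = 0 ∧ s.arr 1 v = 0) :
    s.HoldsShape c.toTree := by
  induction c with
  | single v => exact hz v hc
  | comb a sd P L S ihP ihL ihS =>
    obtain ⟨c1, c2, c3, c4, c5⟩ := hc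
    obtain ⟨h1, h2, h3, h4, h5, h6, h7, h8, h9, h10, h11⟩ := h
    exact ⟨h1, h2, ⟨h3, h4, ihP h9 c3, ihL h10 c4⟩, ihS h11 c5⟩

theorem Cluster.Stored.of_mark {k v : ℕ} {sd : Bool} {s : RamState} {c : Cluster}
    (h : c.Stored k s) (hm : c.Mark sd v) :
    s.arr (k + 2) v = (bif sd then 1 else 0) ∧ s.arr (k + 3) v = (bif sd then 0 else 1) := by
  induction c with
  | single v => exact hm.elim
  | comb a sd P L S ihP ihL ihS =>
    obtain ⟨h1, h2, h3, h4, h5, h6, h7, h8, h9, h10, h11⟩ := h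
    rcases hm with ⟨rfl, rfl⟩ | hm | hm | hm
    exacts [⟨h5, h6⟩, ihP h9 hm, ihL h10 hm, ihS h11 hm]

/-- The three cases are old nodes, upper nodes of combinations and lower nodes; together with
`of_mark` this determines the two new label arrays on all of `T'`. -/
theorem Cluster.Stored.mark_or {k n f v : ℕ} {s : RamState} {c : Cluster} (h : c.Stored k s)
    (hc : c.InRange n f) (hv : v ∈ c.toTree.nodes) :
    v < n ∨ (∃ sd, c.Mark sd v) ∨ s.arr (k + 2) v = 0 ∧ s.arr (k + 3) v = 0 := by
  induction c with
  | single w => exact Or.inl ((List.mem_singleton.1 hv).symm ▸ hc)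
  | comb a sd P L S ihP ihL ihS =>
    obtain ⟨c1, c2, c3, c4, c5⟩ := hc
    obtain ⟨h1, h2, h3, h4, h5, h6, h7, h8, h9, h10, h11⟩ := h
    simp only [toTree, BinTree.nodes, List.mem_cons, List.mem_append] at hv
    rcases hv with rfl | (rfl | hv | hv) | hv
    · exact Or.inr (Or.inl ⟨sd, Or.inl ⟨rfl, rfl⟩⟩)
    · exact Or.inr (Or.inr ⟨h7, h8⟩)
    · rcases ihP h9 c3 hv with h | ⟨sd, h⟩ | h
      exacts [Or.inl h, Or.inr (Or.inl ⟨sd, Or.inr (Or.inl h)⟩), Or.inr (Or.inr h)]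
    · rcases ihL h10 c4 hv with h | ⟨sd, h⟩ | h
      exacts [Or.inl h, Or.inr (Or.inl ⟨sd, Or.inr (Or.inr (Or.inl h))⟩), Or.inr (Or.inr h)]
    · rcases ihS h11 c5 hv with h | ⟨sd, h⟩ | h
      exacts [Or.inl h, Or.inr (Or.inl ⟨sd, Or.inr (Or.inr (Or.inr h))⟩), Or.inr (Or.inr h)]

open Classical in
/-- The labels of the new nodes. -/
noncomputable def Cluster.labeling (k : ℕ) (c : Cluster) : Labeling (k + 2) := fun v =>
  Finset.univ.filter fun l => l.val = k ∧ c.Mark true v ∨ l.val = k + 1 ∧ c.Mark false v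

theorem Cluster.mem_labeling {k v : ℕ} {c : Cluster} {l : Fin (k + 2)} :
    l ∈ c.labeling k v ↔ l.val = k ∧ c.Mark true v ∨ l.val = k + 1 ∧ c.Mark false v := by
  simp [labeling]

theorem Labeling.mem_extend_of_lt {k k' n v : ℕ} {hk : k ≤ k'} {lam : Labeling k}
    {mu : Labeling k'} {l : Fin k'} (hv : v < n) :
    l ∈ lam.extend hk n mu v ↔ ∃ h : l.val < k, ⟨l, h⟩ ∈ lam v := by
  simp only [extend, if_pos hv, Finset.mem_map]
  constructor
  · rintro ⟨l', hl', rfl⟩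
    exact ⟨l'.2, hl'⟩
  · rintro ⟨h, hl⟩
    exact ⟨_, hl, rfl⟩

theorem Labeling.mem_extend_of_le {k k' n v : ℕ} {hk : k ≤ k'} {lam : Labeling k}
    {mu : Labeling k'} {l : Fin k'} (hv : n ≤ v) : l ∈ lam.extend hk n mu v ↔ l ∈ mu v := by
  simp only [extend, if_neg (not_lt.2 hv)]

theorem Labeling.toggle_extend {k k' n v : ℕ} (hk : k ≤ k') (lam : Labeling k) (mu : Labeling k')
    (l : Fin k) (hv : v < n) :
    (lam.toggle v l).extend hk n mu = (lam.extend hk n mu).toggle v (l.castLE hk) := by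
  funext u
  by_cases hu : u = v
  · subst hu
    have hmem : l.castLE hk ∈ (lam u).map (Fin.castLEEmb hk) ↔ l ∈ lam u := by
      simp [Finset.mem_map]
    simp only [extend, toggle, Function.update_self, if_pos hv, hmem]
    split_ifs
    · exact Finset.map_erase _ _ _
    · exact Finset.map_insert _ _ _
  · simp only [extend, toggle, Function.update_of_ne hu]

theorem RamState.IsInput.ramInv {k : ℕ} {T : BinTree} {lam : Labeling k} {s : RamState}
    (hs : s.IsInput T lam) (hT : ∀ v, v ∈ T.nodes ↔ v < T.size) (hd : T.nodes.Nodup) :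
    RamInv k T.size s (((s.setReg 7 1).setReg 2 (s.reg 0)).setReg 6 (s.arr 0 (s.reg 1)))
      (ClusterTree.ofTree T) T.size := by
  obtain ⟨⟨h0, h1, h2, -⟩, h4, h5⟩ := hs
  have hlen := (ClusterTree.ofTree T).length_nodes
  rw [ClusterTree.nodes_ofTree] at hlen
  constructor
  · exact (pointers_ofTree h2 fun v => h5 _ v (Or.inl (by omega))).congr fun _ _ => ⟨rfl, rfl, rfl⟩
  · exact ClusterTree.all_ofTree fun _ _ => trivial
  · exact ClusterTree.all_ofTree fun v hv => (hT v).1 hv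
  · rw [ClusterTree.nodes_ofTree]
    exact fun v hv => (hT v).1 hv
  · rwa [ClusterTree.nodes_ofTree]
  · exact le_rfl
  · simp only [BinTree.size]; omega
  · exact fun x _ => ⟨h5 _ x (Or.inl (by omega)), h5 _ x (Or.inl (by omega))⟩
  · exact fun x _ => ⟨h5 _ x (Or.inl (by omega)), h5 _ x (Or.inl (by omega))⟩
  · exact fun _ _ _ => rfl
  · simpa [RamState.reg_setReg] using h0
  · simpa [RamState.reg_setReg, ClusterTree.root_ofTree] using h1
  · simpa [RamState.reg_setReg] using h0
  · simpa [RamState.reg_setReg] using h4 5 (by omega)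
  · simp [RamState.reg_setReg, RamState.arr_setReg, ClusterTree.root_ofTree, h1]
  · simp [RamState.reg_setReg]

theorem RamState.IsInput.build {k B N f : ℕ} {T : BinTree} {lam : Labeling k} {s : RamState}
    {W : ClusterTree} (hs : s.IsInput T lam) (hT : ∀ v, v ∈ T.nodes ↔ v < T.size)
    (hd : T.nodes.Nodup) (hN : ClusterTree.roundPair^[N] (ClusterTree.ofTree T, T.size) = (W, f))
    (hW : W.IsLeaf) (hsize : W.cluster.toTree.size = f) (hB : 2 * T.size + 1 ≤ B) :
    ∃ t s', t ≤ 400 * T.size ∧ RamExec B (buildProg k) s t s' ∧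
      s'.Holds W.cluster.toTree
        (lam.extend (Nat.le_add_right k 2) T.size (W.cluster.labeling k)) := by
  have hinv := hs.ramInv hT hd
  set s₁ := ((s.setReg 7 1).setReg 2 (s.reg 0)).setReg 6 (s.arr 0 (s.reg 1)) with hs₁
  obtain ⟨t, s₂, ht, he, h₂⟩ := RamInv.loop N (x := (ClusterTree.ofTree T, T.size)) hinv hB
    (by rw [hN]; exact hW)
  rw [hN] at h₂
  simp only [ClusterTree.nodes_ofTree] at ht
  change t ≤ 316 * T.size + 1 at ht
  obtain ⟨t', s₃, ht', he', r3, hreg, harr, hcell⟩ := clearBody_iter (B := B) (n := T.size)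
    (s := s₂.setReg 3 (s₂.reg 0 + s₂.reg 5)) (by simp [RamState.reg_setReg, h₂.reg_zero, h₂.reg_five])
    (by simp [RamState.reg_setReg, h₂.reg_five]) (by simp [RamState.reg_setReg, h₂.reg_seven])
  simp only [RamState.arr_setReg, RamState.reg_setReg] at hreg harr hcell
  have hpos : 0 < T.size := by
    rw [BinTree.size, List.length_pos_iff]
    exact List.ne_nil_of_mem T.root_mem_nodes
  -- With one leaf left, the invariant gives `f = 2 * T.size - 1`, which is also the size of the
  -- balanced tree.
  have hle := h₂.leaves
  rw [hW.leaves_eq] at hle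
  have hle' := h₂.le
  have q0 : s₃.reg 0 = T.size := by rw [hreg 0 (by omega)]; simp [h₂.reg_zero]
  have q1 : s₃.reg 1 = W.root := by rw [hreg 1 (by omega)]; simp [h₂.reg_one]
  have q2 : s₃.reg 2 = f := by rw [hreg 2 (by omega)]; simp [h₂.reg_two]
  have q5 : s₃.reg 5 = 0 := by rw [hreg 5 (by omega)]; simp [h₂.reg_five]
  have q8 : W.root + s₃.arr (k + 4) W.root = W.cluster.toTree.root := by
    rw [harr _ (by omega)]; exact h₂.pointers.root
  have hroot : W.cluster.toTree.root < f := h₂.inRange.cluster.root_lt h₂.le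
  have hfB : f ≤ B := by simp only at hle; omega
  have hrB : W.root + s₃.arr (k + 4) W.root ≤ B := by omega
  set s₄ := ((s₃.setReg 8 (s₃.arr (k + 4) W.root)).setReg 1 W.cluster.toTree.root).setReg 0 f
    with hs₄
  have e₁ : RamExec B (.add 2 0 5) (s.setReg 7 1) 1 ((s.setReg 7 1).setReg 2 (s.reg 0)) := by
    have h0 : s.reg 0 = T.size := hs.1.1
    have h5 : s.reg 5 = 0 := hs.2.1 5 (by omega)
    have := RamExec.add (W := B) (s.setReg 7 1) 2 0 5
    simp only [RamState.reg_setReg] at this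
    simpa [h5] using this (by simp [h0, h5]; omega)
  have e₂ : RamExec B (.load 6 0 1) ((s.setReg 7 1).setReg 2 (s.reg 0)) 1 s₁ := by
    have := RamExec.load (W := B) ((s.setReg 7 1).setReg 2 (s.reg 0)) 6 0 1
    simpa [RamState.reg_setReg, RamState.arr_setReg] using this
  have e₃ : RamExec B (.load 8 (k + 4) 1) s₃ 1 (s₃.setReg 8 (s₃.arr (k + 4) W.root)) := by
    have := RamExec.load (W := B) s₃ 8 (k + 4) 1
    rwa [q1] at this
  have e₄ : RamExec B (.add 1 1 8) (s₃.setReg 8 (s₃.arr (k + 4) W.root)) 1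
      ((s₃.setReg 8 (s₃.arr (k + 4) W.root)).setReg 1 W.cluster.toTree.root) := by
    have := RamExec.add (W := B) (s₃.setReg 8 (s₃.arr (k + 4) W.root)) 1 1 8
    simp only [RamState.reg_setReg] at this
    simpa [q1, q8] using this (by simpa [q1] using hrB)
  have e₅ : RamExec B (.add 0 2 5) ((s₃.setReg 8 (s₃.arr (k + 4) W.root)).setReg 1
      W.cluster.toTree.root) 1 s₄ := by
    have := RamExec.add (W := B) ((s₃.setReg 8 (s₃.arr (k + 4) W.root)).setReg 1
      W.cluster.toTree.root) 0 2 5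
    simp only [RamState.reg_setReg] at this
    simpa [q2, q5] using this (by simpa [q2, q5] using hfB)
  refine ⟨1 + (1 + (1 + (t + (1 + ((t' + 1) + (1 + (1 + (1 + 1)))))))), s₄, by omega,
    .seq (.const s 7 1 (by omega)) (.seq e₁ (.seq e₂ (.seq he (.seq (.add s₂ 3 0 5 ?_)
    (.seq (he'.exec r3) (.seq e₃ (.seq e₄ (.seq e₅ (.skip _))))))))), ?_⟩
  · rw [h₂.reg_zero, h₂.reg_five]; omega
  have hst : W.cluster.Stored k s₃ := h₂.stored.cluster.congr h₂.inRange.cluster fun x hx _ a ha => by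
    by_cases h2 : a < 2
    · rw [hcell a h2, if_neg (by omega)]
    · rw [harr a (by omega)]
  have hsh : s₃.HoldsShape W.cluster.toTree := hst.holdsShape h₂.inRange.cluster fun v hv =>
    ⟨by rw [hcell 0 (by omega), if_pos hv], by rw [hcell 1 (by omega), if_pos hv]⟩
  refine ⟨?_, ?_, hsh.congr rfl rfl, ?_⟩
  · rw [hsize]; simp [hs₄, RamState.reg_setReg]
  · simp [hs₄, RamState.reg_setReg]
  intro v hv l
  have harr₄ : s₄.arr (2 + l) v = s₂.arr (2 + l) v := by
    rw [show s₄.arr = s₃.arr from rfl, harr _ (by omega)]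
  rw [harr₄]
  have hl3 : l.val < k ∨ l.val = k ∨ l.val = k + 1 := by omega
  by_cases hvn : v < T.size
  · simp only [Labeling.mem_extend_of_lt hvn]
    rcases hl3 with hl | hl | hl
    · rw [h₂.labels _ (by omega) (by omega)]
      have := hs.1.2.2.2 v ((hT v).2 hvn) ⟨l, hl⟩
      simpa [hl] using this
    · rw [if_neg (by rintro ⟨h, -⟩; omega), hl, add_comm]
      exact (h₂.unlabeled v hvn).1
    · rw [if_neg (by rintro ⟨h, -⟩; omega), hl, add_comm, add_assoc]
      exact (h₂.unlabeled v hvn).2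
  · have hvn' : T.size ≤ v := not_lt.1 hvn
    have hmem : l ∈ lam.extend (Nat.le_add_right k 2) T.size (W.cluster.labeling k) v ↔
        l.val = k ∧ W.cluster.Mark true v ∨ l.val = k + 1 ∧ W.cluster.Mark false v :=
      (Labeling.mem_extend_of_le hvn').trans Cluster.mem_labeling
    have hst₂ := h₂.stored.cluster
    have hor := hst₂.mark_or h₂.inRange.cluster hv
    rcases hl3 with hl | hl | hl
    -- New nodes carry no old label: the contraction does not touch these arrays, and the input is 0
    -- outside the nodes of `T`.
    · rw [if_neg (fun h => by have := hmem.1 h; omega), h₂.labels _ (by omega) (by omega)]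
      exact hs.2.2 _ v (Or.inr fun h => hvn ((hT v).1 h))
    · rw [hl, add_comm 2 k]
      by_cases hm : W.cluster.Mark true v
      · rw [if_pos (hmem.2 (Or.inl ⟨hl, hm⟩))]
        exact (hst₂.of_mark hm).1
      · rw [if_neg (fun h => by simpa [hm, hl] using hmem.1 h)]
        rcases hor with h | ⟨sd, h⟩ | h
        · exact absurd h hvn
        · cases sd
          · exact (hst₂.of_mark h).1
          · exact absurd h hm
        · exact h.1
    · rw [hl, show 2 + (k + 1) = k + 3 by omega]
      by_cases hm : W.cluster.Mark false v
      · rw [if_pos (hmem.2 (Or.inr ⟨hl, hm⟩))]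
        exact (hst₂.of_mark hm).2
      · rw [if_neg (fun h => by simpa [hm, hl] using hmem.1 h)]
        rcases hor with h | ⟨sd, h⟩ | h
        · exact absurd h hvn
        · cases sd
          · exact absurd h hm
          · exact (hst₂.of_mark h).2
        · exact h.2

/-! ### The program that carries out relabelings -/

/-- Complement the entry of the array `i + j` whose address is in register `2`, where `j < m` is the
content of register `4`. -/
def toggleProg (i : ℕ) : ℕ → RamProg
  | 0 => .skip
  | m + 1 => .cond 4 (.seq (.sub 4 4 5) (toggleProg (i + 1) m))
      (.block [.load 6 i 2, .sub 6 5 6, .store i 2 6])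

/-- An array cannot be addressed through a register, so the label is found by a cascade of tests
whose depth is the size of the alphabet, a constant. -/
theorem toggleProg_spec {W i m j : ℕ} {s : RamState} (h4 : s.reg 4 = j) (h5 : s.reg 5 = 1)
    (hj : j < m) :
    (toggleProg i m).Safe W s ∧
      (∀ x, x ≠ 4 → x ≠ 6 → ((toggleProg i m).run s).reg x = s.reg x) ∧
      ((toggleProg i m).run s).arr = Function.update s.arr (i + j)
        (Function.update (s.arr (i + j)) (s.reg 2) (1 - s.arr (i + j) (s.reg 2))) := by
  induction m generalizing i j s with
  | zero => omega
  | succ m ih =>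
    cases j with
    | zero =>
      refine ⟨?_, ?_, ?_⟩
      · simp [toggleProg, RamProg.Safe, RamProg.block, h4]
      · intro x x4 x6
        simp [toggleProg, RamProg.run, RamProg.block, RamState.reg_setReg, RamState.reg_setArr, h4,
          x6]
      · simp [toggleProg, RamProg.run, RamProg.block, RamState.setArr, RamState.setReg, h4, h5]
    | succ j =>
      obtain ⟨h1, h2, h3⟩ := ih (i := i + 1) (j := j) (s := s.setReg 4 (s.reg 4 - s.reg 5))
        (by simp [RamState.reg_setReg, h4, h5]) (by simp [RamState.reg_setReg, h5]) (by omega)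
      have hne : s.reg 4 ≠ 0 := by omega
      refine ⟨?_, ?_, ?_⟩
      · simp only [toggleProg, RamProg.Safe, if_pos hne]
        exact ⟨trivial, h1⟩
      · intro x x4 x6
        simp only [toggleProg, RamProg.run, if_pos hne]
        rw [h2 x x4 x6, RamState.reg_setReg, if_neg x4]
      · simp only [toggleProg, RamProg.run, if_pos hne]
        rw [h3, show i + 1 + j = i + (j + 1) by omega]
        simp [RamState.arr_setReg, RamState.reg_setReg]

/-- The program that carries out the relabeling in the registers `2` and `3`. -/
def updateProg (k : ℕ) : RamProg :=
  .seq (.const 5 1) (.seq (.const 4 0) (.seq (.add 4 4 3) (toggleProg 2 k)))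

theorem RamState.Holds.update {k k' B v : ℕ} (hk : k ≤ k') {T : BinTree} {lam : Labeling k'}
    {s : RamState} (h : s.Holds T lam) (l : Fin k) (h2 : s.reg 2 = v) (h3 : s.reg 3 = l)
    (hB : 1 ≤ B) (hkB : k ≤ B) :
    ∃ t s', t ≤ (updateProg k).len ∧ RamExec B (updateProg k) s t s' ∧ s'.reg 2 = v ∧
      s'.reg 3 = l ∧ s'.Holds T (lam.toggle v (l.castLE hk)) := by
  have hl := l.2
  set s₁ := ((s.setReg 5 1).setReg 4 0).setReg 4 l with hs₁
  obtain ⟨hsafe, hreg, harr⟩ := toggleProg_spec (W := B) (i := 2) (m := k) (j := l) (s := s₁)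
    (by simp [hs₁, RamState.reg_setReg]) (by simp [hs₁, RamState.reg_setReg]) hl
  have hs : (updateProg k).Safe B s := by
    refine ⟨hB, Nat.zero_le _, ?_, ?_⟩
    · simp [RamProg.Safe, RamProg.run, RamState.reg_setReg, h3]; omega
    · simpa [RamProg.run, RamState.reg_setReg, h3] using hsafe
  have hrun : (updateProg k).run s = (toggleProg 2 k).run s₁ := by
    simp [updateProg, RamProg.run, RamState.reg_setReg, h3, hs₁]
  obtain ⟨t, ht, he⟩ := hs.exec
  rw [hrun] at he
  have hreg' : ∀ x, x < 4 → ((toggleProg 2 k).run s₁).reg x = s.reg x := fun x hx => by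
    rw [hreg x (by omega) (by omega)]
    simp [hs₁, RamState.reg_setReg, show x ≠ 4 by omega, show x ≠ 5 by omega]
  have hr2 : s₁.reg 2 = v := by simp [hs₁, RamState.reg_setReg, h2]
  rw [hr2, show s₁.arr = s.arr from rfl] at harr
  refine ⟨t, _, ht, he, (hreg' 2 (by omega)).trans h2, (hreg' 3 (by omega)).trans h3, ?_⟩
  obtain ⟨g0, g1, g2, g3⟩ := h
  refine ⟨(hreg' 0 (by omega)).trans g0, (hreg' 1 (by omega)).trans g1, g2.congr ?_ ?_, ?_⟩
  · rw [harr, Function.update_of_ne (by omega)]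
  · rw [harr, Function.update_of_ne (by omega)]
  intro u hu l'
  have hg := g3 u hu l'
  rw [harr]
  have hll : (2 + l'.val = 2 + l.val) ↔ l' = l.castLE hk := by
    rw [Fin.ext_iff, Fin.val_castLE]; omega
  by_cases hl' : l' = l.castLE hk
  · subst hl'
    simp only [Fin.val_castLE] at hg ⊢
    rw [Function.update_self, Labeling.toggle]
    by_cases huv : u = v
    · subst huv
      rw [Function.update_self, hg, Function.update_self]
      by_cases hm : l.castLE hk ∈ lam u <;> simp [hm]
    · rw [Function.update_of_ne huv, hg, Function.update_of_ne huv]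
  · rw [Function.update_of_ne (mt hll.1 hl'), hg, Labeling.toggle]
    by_cases huv : u = v
    · subst huv
      rw [Function.update_self]
      by_cases hm : l.castLE hk ∈ lam u <;> simp [hm, hl']
    · rw [Function.update_of_ne huv]

/-! ### The main theorem -/

theorem BinTree.Numbered.mem_nodes_iff {T : BinTree} (h : T.Numbered) (v : ℕ) :
    v ∈ T.nodes ↔ v < T.size := by
  rw [List.Perm.mem_iff h, List.mem_range]

theorem BinTree.Numbered.nodup {T : BinTree} (h : T.Numbered) : T.nodes.Nodup :=
  (List.Perm.nodup_iff h).2 List.nodup_range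

theorem mainTheorem4 :
    ∃ F : ℕ → ℕ, Computable F ∧
      ∀ (k p m : ℕ) (Q : MSO k p m),
        ∃ (k' : ℕ) (hk : k ≤ k') (Q' : MSO k' p m),
          F Q.queryCode = Q'.queryCode ∧
          ∃ (build update : RamProg) (c : ℕ),
            ∀ T : BinTree, T.Numbered →
              ∃ (T' : BinTree) (mu : Labeling k'),
                T'.Numbered ∧
                (∀ v ∈ T.nodes, v ∈ T'.nodes) ∧
                T'.height ≤ c * Nat.log 2 (T.size + 1) ∧
                -- the answers are the same for every labeling
                (∀ lam : Labeling k,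
                  Q'.answers T' (lam.extend hk T.size mu) = Q.answers T lam) ∧
                -- the conversion takes linear time
                (∀ (lam : Labeling k) (s : RamState), s.IsInput T lam →
                  ∃ (t : ℕ) (s' : RamState), t ≤ c * T.size ∧
                    RamExec (c * T.size) build s t s' ∧
                    s'.Holds T' (lam.extend hk T.size mu)) ∧
                -- relabelings are translated (and carried out) in constant time
                (∀ v ∈ T.nodes, ∀ l : Fin k, ∃ v' ∈ T'.nodes, ∃ l' : Fin k',
                  ∀ lam : Labeling k,
                    (lam.toggle v l).extend hk T.size mu =
                      (lam.extend hk T.size mu).toggle v' l' ∧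
                    ∀ s : RamState, s.Holds T' (lam.extend hk T.size mu) →
                      s.reg 2 = v → s.reg 3 = l →
                      ∃ (t : ℕ) (s' : RamState), t ≤ c ∧
                        RamExec (c * T.size) update s t s' ∧
                        s'.reg 2 = v' ∧ s'.reg 3 = l' ∧
                        s'.Holds T' ((lam.extend hk T.size mu).toggle v' l')) := by
  -- In the constant, 400 covers the building time, the word bound `2 * T.size + 1` and the height
  -- factor 6; `k` bounds the label number that is copied in an update; the last summand is the
  -- update time.
  refine ⟨QueryCode.translate, QueryCode.computable_translate, fun k p m Q => ⟨k + 2,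
    Nat.le_add_right k 2, Q.translate, (MSO.queryCode_translate Q).symm, buildProg k, updateProg k,
    400 + k + (updateProg k).len, fun T hT => ?_⟩⟩
  have hmem := hT.mem_nodes_iff
  have hd := hT.nodup
  have hpos : 0 < T.size := by
    rw [BinTree.size, List.length_pos_iff]
    exact List.ne_nil_of_mem T.root_mem_nodes
  have hc (a : ℕ) (ha : a ≤ 400 + k + (updateProg k).len) :
      a * T.size ≤ (400 + k + (updateProg k).len) * T.size := Nat.mul_le_mul_right _ ha
  have hone : 400 + k ≤ (400 + k + (updateProg k).len) * T.size :=
    (Nat.le_mul_of_pos_right _ hpos).trans (hc (400 + k) (by omega))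
  have hB : 2 * T.size + 1 ≤ (400 + k + (updateProg k).len) * T.size := by
    have := hc 3 (by omega); omega
  have hlen := (ClusterTree.ofTree T).length_nodes
  rw [ClusterTree.nodes_ofTree, ← BinTree.size] at hlen
  set j := Nat.log 2 (T.size + 1) with hj
  -- A full binary tree with `T.size` nodes has `(T.size + 1) / 2` leaves, which is below `2 ^ j`.
  have hleaf := ClusterTree.isLeaf_iterate j (ClusterTree.ofTree T, T.size) (by
    have := Nat.lt_pow_succ_log_self one_lt_two (T.size + 1)
    rw [← hj, pow_succ] at this
    simp only
    omega)
  obtain ⟨hids, hedge, hle, hrange, hheight, -⟩ := ClusterTree.iterate_spec (ClusterTree.ofTree T)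
    T.size (3 * j) (ClusterTree.all_ofTree fun v hv => (hmem v).1 hv)
    (ClusterTree.all_ofTree fun _ _ => le_rfl)
  obtain ⟨⟨W, f⟩, hWf⟩ : ∃ x, ClusterTree.roundPair^[3 * j] (ClusterTree.ofTree T, T.size) = x :=
    ⟨_, rfl⟩
  rw [hWf] at hleaf hids hedge hle hrange hheight
  simp only at hleaf hids hedge hle hrange hheight
  cases W with
  | node v c l r => exact hleaf.elim
  | leaf v c =>
  have hperm : c.toTree.nodes.Perm (List.range f) := by
    rw [← Multiset.coe_eq_coe, Cluster.coe_nodes_toTree]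
    -- Since `T` is numbered by the initial segment, this segment cancels in `hids`, and the
    -- identifiers of the last cluster are exactly the numbers below `f`.
    have : ((ClusterTree.ofTree T).ids : Multiset ℕ) = Multiset.range T.size := by
      rw [ClusterTree.ids_ofTree]
      exact Multiset.coe_eq_coe.2 hT
    rw [this, add_comm] at hids
    exact add_left_cancel hids
  have hsize : c.toTree.size = f := by
    rw [BinTree.size, hperm.length_eq, List.length_range]
  have hT' : c.toTree.Numbered := by
    rw [BinTree.Numbered, hsize]; exact hperm
  have hmem' : ∀ v, v ∈ c.toTree.nodes ↔ v < f := fun v => by rw [hT'.mem_nodes_iff, hsize]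
  have hsub : ∀ v ∈ T.nodes, v ∈ c.toTree.nodes := fun v hv =>
    (hmem' v).2 (((hmem v).1 hv).trans_le hle)
  have hrc : c.InRange T.size f := hrange
  have hleaves : ∀ v ∈ T.nodes, ∀ w, ¬ c.toTree.Child1 v w := fun v hv =>
    (hrc.lt_iff (hsub v hv)).1 ((hmem v).1 hv)
  -- On old nodes `lam` provides only labels below `k`, and marked nodes are never old; so the two
  -- new labels denote the marks whatever `lam` is.
  have hlabel (lam : Labeling k) (sd : Bool) (l : Fin (k + 2)) (hl : l = bif sd then k else k + 1) :
      (fun a => l ∈ lam.extend (Nat.le_add_right k 2) T.size (c.labeling k) a) =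
        fun a => c.Mark sd a := by
    funext a
    by_cases ha : a < T.size
    · rw [Labeling.mem_extend_of_lt ha]
      refine propext ⟨?_, fun h => absurd (hrc.le_of_mark h) (by omega)⟩
      rintro ⟨h, -⟩
      cases sd <;> simp at hl <;> omega
    · rw [Labeling.mem_extend_of_le (not_lt.1 ha), Cluster.mem_labeling]
      cases sd <;> simp at hl <;> simp [hl]
  refine ⟨c.toTree, c.labeling k, hT', hsub, ?_, fun lam => ?_, fun lam s hs => ?_, ?_⟩
  · have : c.toTree.height ≤ 2 * (3 * j) := hheight
    refine this.trans ?_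
    rw [← mul_assoc]
    exact Nat.mul_le_mul_right j (by omega)
  · refine MSO.Interprets.answers_eq ⟨fun v => ?_, fun v hv l => ?_, fun u hu v hv => ?_,
      fun u hu v hv => ?_⟩ Q
    · exact ⟨fun hv => ⟨hsub v hv, hleaves v hv⟩, fun hv =>
        (hmem v).2 ((hrc.lt_iff hv.1).2 hv.2)⟩
    · rw [Labeling.mem_extend_of_lt ((hmem v).1 hv)]
      exact ⟨fun h => h.2, fun h => ⟨l.2, h⟩⟩
    · rw [hlabel lam true ⟨k, by omega⟩ rfl, hlabel lam false ⟨k + 1, by omega⟩ rfl,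
        ← (ClusterTree.edge_ofTree T u v).1, ← hedge]
      exact Cluster.edge_iff_edgeRel hT'.nodup true (hleaves u hu) (hleaves v hv)
    · rw [hlabel lam true ⟨k, by omega⟩ rfl, hlabel lam false ⟨k + 1, by omega⟩ rfl,
        ← (ClusterTree.edge_ofTree T u v).2, ← hedge]
      exact Cluster.edge_iff_edgeRel hT'.nodup false (hleaves u hu) (hleaves v hv)
  · obtain ⟨t, s', ht, he, hh⟩ := hs.build hmem hd hWf trivial hsize hB
    exact ⟨t, s', ht.trans (hc 400 (by omega)), he, hh⟩
  · intro v hv l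
    refine ⟨v, hsub v hv, l.castLE (Nat.le_add_right k 2), fun lam =>
      ⟨Labeling.toggle_extend _ lam _ l ((hmem v).1 hv), fun s hs h2 h3 => ?_⟩⟩
    obtain ⟨t, s', ht, he, r2, r3, hh⟩ := hs.update (B := (400 + k + (updateProg k).len) * T.size)
      (Nat.le_add_right k 2) l h2 h3 (by omega) (by omega)
    exact ⟨t, s', ht.trans (by omega), he, r2, r3, hh⟩
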